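/- Identify $\mathbb{C}(t)$ with a subfield of the field $\mathbb{C}((t))$ of formal Laurent series by expansion at $0$. Let $R\in\mathbb{C}(t)$ be a nonzero rational function, regular at $0$ with $R(0)=0$, such that no iterate $R^{\circ n}=R\circ\cdots\circ R$ ($n\ge 1$) is the identity, and let $\Phi_R$ be the field endomorphism $f(t)\mapsto f(R(t))$ of $\mathbb{C}((t))$. Put $\mathbb{F}=\mathbb{C}((t))$ if $R'(0)\neq 0$. If $R'(0)=0$, put $\mathbb{F}=\mathbb{C}((t))(\log t)$, where $\log t$ is transcendental over $\mathbb{C}((t))$; extend $\frac{d}{dt}$ to $\mathbb{F}$ by $\frac{d}{dt}\log t=\frac1t$, and, writing $R=r\,t^d(1+u)$ with $r\in\mathbb{C}\setminus\{0\}$, $d\geq 2$ and $u\in t\mathbb{C}[[t]]$, extend $\Phi_R$ to $\mathbb{F}$ by $\Phi_R(\log t)=d\log t+\log r+\sum_{n\geq 1}\frac{(-1)^{n+1}}{n}u^n$ for some choice of the complex logarithm $\log r$. An element $f$ of $\mathbb{F}$ is called differentially algebraic over $\mathbb{C}(t)$ if there are an integer $n\ge 0$ and a nonzero polynomial $P$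 in $n+1$ variables with coefficients in $\mathbb{C}(t)$ such that $P(f,f',\dots,f^{(n)})=0$, the derivatives being taken with respect to $\frac{d}{dt}$; otherwise $f$ is called differentially transcendental over $\mathbb{C}(t)$. Assume that there exists $\Psi\in\mathbb{F}$ with $\Phi_R(\Psi)=R'\,\Psi$ that is differentially transcendental over $\mathbb{C}(t)$. Let $b\in\mathbb{C}(t)$ and let $f\in\mathbb{C}((t))$ satisfy $\Phi_R(f)=f+b$. Then either $f\in\mathbb{C}(t)$, or $f$ is differentially transcendental over $\mathbb{C}(t)$. -/

import Mathlib

noncomputable section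

namespace IterFE

/-- Let `F` be an extension of `K` through `ι`, with a derivation `D`. An element `f` of `F` is
differentially algebraic over `K` if some nonzero polynomial over `K` in finitely many variables
vanishes at `(f, D f, …, Dⁿ f)`. -/
def DiffAlgebraic {K F : Type*} [Field K] [Field F] (ι : K →+* F) (D : F → F) (f : F) : Prop :=
  ∃ (n : ℕ) (P : MvPolynomial (Fin (n + 1)) K),
    P ≠ 0 ∧ MvPolynomial.eval₂ ι (fun i : Fin (n + 1) => D^[(i : ℕ)] f) P = 0

/-- Differential transcendence: the negation of differential algebraicity. -/
def DiffTranscendental {K F : Type*} [Field K] [Field F] (ι : K →+* F) (D : F → F) (f : F) :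
    Prop :=
  ¬ DiffAlgebraic ι D f

open scoped RatFunc in
/-- The inclusion of `ℂ(t)` in `ℂ((t))` by expansion at `0`. -/
def ratToLaurent : RatFunc ℂ →+* LaurentSeries ℂ :=
  algebraMap (RatFunc ℂ) (LaurentSeries ℂ)

/-- A Laurent series is rational if it is the expansion at `0` of an element of `ℂ(t)`. -/
def IsRational (f : LaurentSeries ℂ) : Prop :=
  ∃ q : RatFunc ℂ, ratToLaurent q = f

/-- The inclusion of power series in Laurent series. -/
abbrev toLaurent : PowerSeries ℂ →+* LaurentSeries ℂ := HahnSeries.ofPowerSeries ℤ ℂ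

/-- The `n`-th iterate `R ∘ ⋯ ∘ R` of a power series without constant term. -/
def iter (R : PowerSeries ℂ) (n : ℕ) : PowerSeries ℂ :=
  (fun g : PowerSeries ℂ => g.subst R)^[n] PowerSeries.X

/-- `f ↦ f(R(t))` from power series to Laurent series. -/
def compPower (R : PowerSeries ℂ) (h0 : PowerSeries.constantCoeff R = 0) :
    PowerSeries ℂ →+* LaurentSeries ℂ :=
  toLaurent.comp
    (PowerSeries.substAlgHom (R := ℂ) (PowerSeries.HasSubst.of_constantCoeff_zero' h0)).toRingHom

theorem compPower_apply (R : PowerSeries ℂ) (h0 : PowerSeries.constantCoeff R = 0)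
    (g : PowerSeries ℂ) : compPower R h0 g = toLaurent (g.subst R) := by
  have h := PowerSeries.coe_substAlgHom (R := ℂ) (PowerSeries.HasSubst.of_constantCoeff_zero' h0)
  exact congrArg toLaurent (congrFun h g)

theorem isUnit_compPower_X (R : PowerSeries ℂ) (h0 : PowerSeries.constantCoeff R = 0)
    (hne : R ≠ 0) : IsUnit (compPower R h0 PowerSeries.X) := by
  rw [compPower_apply, PowerSeries.subst_X (PowerSeries.HasSubst.of_constantCoeff_zero' h0)]
  exact isUnit_iff_ne_zero.mpr
    ((map_ne_zero_iff _ HahnSeries.ofPowerSeries_injective).mpr hne)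

/-- The endomorphism `Φ_R : f(t) ↦ f(R(t))` of `ℂ((t))`, for a nonzero power series `R` without
constant term: the unique extension of `f ↦ f(R(t))` from `ℂ[[t]]` to `ℂ((t)) = ℂ[[t]][t⁻¹]`. -/
def Phi (R : PowerSeries ℂ) (h0 : PowerSeries.constantCoeff R = 0) (hne : R ≠ 0) :
    LaurentSeries ℂ →+* LaurentSeries ℂ :=
  IsLocalization.Away.lift (S := LaurentSeries ℂ) (PowerSeries.X : PowerSeries ℂ)
    (isUnit_compPower_X R h0 hne)

/-- The derivation `d/dt` of `ℂ((t))`. -/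
def ddt (f : LaurentSeries ℂ) : LaurentSeries ℂ := LaurentSeries.derivative ℂ f

section AdjoinIndeterminate

variable {K : Type*} [Field K]

/-- The derivation of `K[T]` that extends `δ` and sends `T` to `s`. -/
def polyDeriv (δ : K → K) (s : K) (p : Polynomial K) : Polynomial K :=
  (p.sum fun n a => Polynomial.monomial n (δ a)) + Polynomial.C s * Polynomial.derivative p

/-- The derivation of `K(T)` that extends `δ` and sends `T` to `s`, by the quotient rule. -/
def ratDeriv (δ : K → K) (s : K) (F : RatFunc K) : RatFunc K :=
  (algebraMap (Polynomial K) (RatFunc K) (polyDeriv δ s F.num) *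
        algebraMap (Polynomial K) (RatFunc K) F.denom -
      algebraMap (Polynomial K) (RatFunc K) F.num *
        algebraMap (Polynomial K) (RatFunc K) (polyDeriv δ s F.denom)) /
    algebraMap (Polynomial K) (RatFunc K) F.denom ^ 2

/-- The endomorphism of `K[T]` that acts as `φ` on `K` and sends `T` to `α T + β`. -/
def polyEndo (φ : K →+* K) (α β : K) : Polynomial K →+* Polynomial K :=
  Polynomial.eval₂RingHom (Polynomial.C.comp φ)
    (Polynomial.C α * Polynomial.X + Polynomial.C β)

theorem polyEndo_injective (φ : K →+* K) {α : K} (hα : α ≠ 0) (β : K) :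
    Function.Injective (polyEndo φ α β) := by
  have hdeg : (Polynomial.C α * Polynomial.X + Polynomial.C β).natDegree = 1 :=
    Polynomial.natDegree_linear hα
  rw [injective_iff_map_eq_zero]
  intro p hp
  have hp' : (p.map φ).comp (Polynomial.C α * Polynomial.X + Polynomial.C β) = 0 := by
    rw [← hp]
    simp [polyEndo, Polynomial.comp, Polynomial.eval₂_map]
  rcases Polynomial.comp_eq_zero_iff.mp hp' with h | ⟨_, h⟩
  · exact (Polynomial.map_eq_zero_iff φ.injective).mp h
  · rw [h] at hdeg
    simp at hdeg

/-- The endomorphism of `K(T)` that acts as `φ` on `K` and sends `T` to `α T + β`, where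
`α ≠ 0`. -/
def ratEndo (φ : K →+* K) (α : K) (hα : α ≠ 0) (β : K) : RatFunc K →+* RatFunc K :=
  RatFunc.mapRingHom (polyEndo φ α β)
    (nonZeroDivisors_le_comap_nonZeroDivisors_of_injective _ (polyEndo_injective φ hα β))

/-- The field `K(T)`. -/
abbrev AdjoinT (K : Type*) [Field K] : Type _ := RatFunc K

/-- The inclusion of `K` in `K(T)`. -/
def baseToAdjoinT (K : Type*) [Field K] : K →+* AdjoinT K := RatFunc.C

end AdjoinIndeterminate

/-- The field `ℂ((t))(log t)`: rational functions over `ℂ((t))` in the indeterminate `log t`. -/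
abbrev LogField : Type := AdjoinT (LaurentSeries ℂ)

/-- The inclusion of `ℂ((t))` in `ℂ((t))(log t)`. -/
def toLog : LaurentSeries ℂ →+* LogField := baseToAdjoinT (LaurentSeries ℂ)

/-- The derivation `d/dt` of `ℂ((t))(log t)`, with `d(log t)/dt = t⁻¹`. -/
def ddtLog : LogField → LogField := ratDeriv ddt (HahnSeries.single (-1 : ℤ) (1 : ℂ))

/-- The order of vanishing `d` of `R` at `0`. -/
def ord (R : PowerSeries ℂ) : ℕ := R.order.toNat

/-- The leading coefficient `r` in `R = r t ^ d + ⋯`. -/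
def leadCoeff (R : PowerSeries ℂ) : ℂ := PowerSeries.coeff (ord R) R

theorem ord_cast_ne_zero (R : PowerSeries ℂ) (h0 : PowerSeries.constantCoeff R = 0)
    (hne : R ≠ 0) : (HahnSeries.C (ord R : ℂ) : LaurentSeries ℂ) ≠ 0 := by
  rw [Ne, map_eq_zero_iff _ HahnSeries.C_injective, Nat.cast_eq_zero]
  intro h
  have h1 : PowerSeries.coeff (ord R) R ≠ 0 := PowerSeries.coeff_order hne
  rw [h] at h1
  exact h1 (by simpa using h0)

/-- The Laurent series part `l + log (R(t) / (r t ^ d))` of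
`log (R(t)) = d log t + l + log (R(t) / (r t ^ d))`, where `l` is a logarithm of `r` and the
last term is the formal power series `log (1 + u) = u - u² / 2 + ⋯`. -/
def logRest (R : PowerSeries ℂ) (l : ℂ) : LaurentSeries ℂ :=
  HahnSeries.C l +
    toLaurent (PowerSeries.logOf (PowerSeries.C (leadCoeff R)⁻¹ * R.divXPowOrder))

/-- The extension of `Φ_R` to `ℂ((t))(log t)` with
`Φ_R(log t) = log (R(t)) = d log t + l + log (R(t) / (r t ^ d))`. The logarithm `l` of the leading
coefficient `r` of `R` is the choice of a branch. -/
def PhiLog (R : PowerSeries ℂ) (h0 : PowerSeries.constantCoeff R = 0) (hne : R ≠ 0) (l : ℂ) :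
    LogField →+* LogField :=
  ratEndo (Phi R h0 hne) (HahnSeries.C (ord R : ℂ)) (ord_cast_ne_zero R h0 hne) (logRest R l)

end IterFE

end

/-!
Write `x' = dx/dt`. Since `Φ_R(Ψ) = R' Ψ`, the derivation `δ = Ψ d/dt` commutes with `Φ_R`, so
`Φ_R(δⁱ f) = δⁱ f + δⁱ b` with `δⁱ b` in `L = ℂ(t)(Ψ, Ψ', …)`. If `f` is differentially algebraic,
it lies in a differential field `M` finitely generated over `ℂ(t)`, so the `δⁱ f` are algebraically
dependent over `L`. As in Ostrowski's theorem, a relation of minimal degree can be chosen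
`Φ_R`-invariant as a polynomial, and its partial derivatives lead to a `Φ_R`-invariant affine
combination `∑ cᵢ δⁱ f + a` with `a ∈ L` and `Φ_R`-invariant `cᵢ`, not all zero. The invariants are
constants because no iterate of `R` is the identity, so `∑ cᵢ δⁱ f` lies in `L`. Now `Ψ` is still
differentially transcendental over `M`, so one may compare the coefficients of a monomial
`Ψᵐ Ψ⁽ᵐ⁾`, and this forces `f` or `f'` to be rational.

If `f' = g' + ∑ c_a / (t - a)` is rational, then `R' Φ_R(f') = f' + b'` says that
`∑ c_a dlog ((R - a) / (t - a))` is exact, and its residues give linear relations with coefficients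
`c_a` among orders of vanishing. A `ℚ`-linear functional that does not kill some `c_a` replaces the
`c_a` by integers `n_a`, not all zero, so that `u = ∏ (t - a) ^ n_a` satisfies `Φ_R(u) = κ u` for a
constant `κ`. The residue of `f'` at `0` vanishes, hence `u` is a unit at `0`, `κ = 1`, and `u` is
constant, which is absurd.
-/

noncomputable section

namespace IterFE

section AffineInvariants

open MvPolynomial

section FixedVector

variable {I L : Type*} [Field L]

theorem exists_map_eq_self_of_map_mem {σ : L →+* L} {W : Submodule L (MvPolynomial I L)}
    (hW : W ≠ ⊥) (hσ : ∀ P ∈ W, map σ P ∈ W) : ∃ P ∈ W, P ≠ 0 ∧ map σ P = P := by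
  obtain ⟨P, ⟨hPW, hP⟩, hmin⟩ := (InvImage.wf (fun P : MvPolynomial I L => P.support.card)
    wellFounded_lt).has_min {P | P ∈ W ∧ P ≠ 0} (W.ne_bot_iff.mp hW)
  obtain ⟨s, hs⟩ := ne_zero_iff.mp hP
  -- `Q` has a coefficient `1`, so the support of `σ Q - Q` is smaller than that of `P`.
  set Q := (coeff s P)⁻¹ • P with hQ
  have hQW : Q ∈ W := W.smul_mem _ hPW
  have hQs : coeff s Q = 1 := by rw [hQ, coeff_smul, smul_eq_mul, inv_mul_cancel₀ hs]
  refine ⟨Q, hQW, ne_zero_iff.mpr ⟨s, by rw [hQs]; exact one_ne_zero⟩, ?_⟩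
  by_contra hne
  refine hmin (map σ Q - Q) ⟨W.sub_mem (hσ Q hQW) hQW, sub_ne_zero.mpr hne⟩
    (Finset.card_lt_card ⟨fun t ht => ?_, fun h => ?_⟩)
  · rw [mem_support_iff] at ht ⊢
    contrapose! ht
    simp [hQ, ht, coeff_map]
  · exact mem_support_iff.mp (h (mem_support_iff.mpr hs)) (by simp [coeff_map, hQs])

end FixedVector

section Shift

variable {I L : Type*} [CommSemiring L]

/-- The endomorphism `P ↦ P^σ(X + b)` of `L[X_i]`, where `P^σ` is the image of `P` under `σ` on
coefficients. If `φ` extends `σ` and `φ(x_i) = x_i + b_i`, it is the action of `φ` on polynomial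
expressions in the `x_i`. -/
def shiftEndo (σ : L →+* L) (b : I → L) : MvPolynomial I L →+* MvPolynomial I L :=
  eval₂Hom (C.comp σ) fun i => X i + C (b i)

@[simp]
theorem shiftEndo_C (σ : L →+* L) (b : I → L) (a : L) : shiftEndo σ b (C a) = C (σ a) := by
  simp [shiftEndo]

@[simp]
theorem shiftEndo_X (σ : L →+* L) (b : I → L) (i : I) :
    shiftEndo σ b (X i) = X i + C (b i) := by
  simp [shiftEndo]

theorem pderiv_shiftEndo (σ : L →+* L) (b : I → L) (i : I) (P : MvPolynomial I L) :
    pderiv i (shiftEndo σ b P) = shiftEndo σ b (pderiv i P) := by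
  classical
  induction P using MvPolynomial.induction_on with
  | C a => simp
  | add p q hp hq => simp [hp, hq]
  | mul_X p j hp =>
    have hX : pderiv i (X j + C (b j)) = shiftEndo σ b (pderiv i (X j)) := by
      by_cases h : i = j <;> simp [pderiv_X, h, Ne.symm]
    simp only [map_mul, shiftEndo_X, pderiv_mul, hp, hX, map_add]

theorem aeval_shiftEndo {F : Type*} [CommSemiring F] [Algebra L F] {σ : L →+* L} {φ : F →+* F}
    (hφ : ∀ a, φ (algebraMap L F a) = algebraMap L F (σ a)) {x : I → F} {b : I → L}
    (hx : ∀ i, φ (x i) = x i + algebraMap L F (b i)) (P : MvPolynomial I L) :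
    aeval x (shiftEndo σ b P) = φ (aeval x P) := by
  induction P using MvPolynomial.induction_on with
  | C a => simp [hφ]
  | add p q hp hq => simp [hp, hq]
  | mul_X p j hp => simp [hp, hx]

theorem totalDegree_pderiv_le (i : I) (P : MvPolynomial I L) :
    (pderiv i P).totalDegree ≤ P.totalDegree - 1 := by
  refine Finset.sup_le fun s hs => ?_
  rw [mem_support_iff, coeff_pderiv] at hs
  have hmem : s + Finsupp.single i 1 ∈ P.support := mem_support_iff.mpr (left_ne_zero_of_mul hs)
  have hle : (s + Finsupp.single i 1).degree ≤ P.totalDegree := le_totalDegree hmem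
  rw [map_add, Finsupp.degree_single] at hle
  exact Nat.le_sub_of_add_le hle

theorem exists_eq_linearCombination_X_add_C {P : MvPolynomial I L} (hP : P.totalDegree ≤ 1) :
    ∃ (c : I →₀ L) (a : L), P = Finsupp.linearCombination L X c + C a := by
  have hlin : homogeneousComponent 1 P ∈ Submodule.span L (Set.range (X : I → MvPolynomial I L)) :=
    homogeneousSubmodule_one_eq_span_X (σ := I) (R := L) ▸ homogeneousComponent_mem 1 P
  obtain ⟨c, hc⟩ := (Finsupp.mem_span_range_iff_exists_finsupp).mp hlin
  refine ⟨c, coeff 0 P, ?_⟩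
  change Finsupp.linearCombination L X c = _ at hc
  rw [hc]
  rcases Nat.le_one_iff_eq_zero_or_eq_one.mp hP with h | h
  · rw [homogeneousComponent_eq_zero 1 P (by omega), zero_add]
    exact totalDegree_eq_zero_iff_eq_C.mp h
  · conv_lhs => rw [← sum_homogeneousComponent P, h]
    simp [Finset.sum_range_succ, homogeneousComponent_zero, add_comm]

theorem totalDegree_lt_of_homogeneousComponent_eq_zero {P : MvPolynomial I L} {n : ℕ} (hn : n ≠ 0)
    (hP : P.totalDegree ≤ n) (h : homogeneousComponent n P = 0) : P.totalDegree < n := by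
  refine (Finset.sup_lt_iff (Nat.pos_of_ne_zero hn)).mpr fun s hs => ?_
  have hsn : s.degree ≠ n := fun hsn => by
    have hcoeff := congrArg (coeff s) h
    rw [coeff_homogeneousComponent, if_pos hsn, coeff_zero] at hcoeff
    exact mem_support_iff.mp hs hcoeff
  exact lt_of_le_of_ne ((le_totalDegree hs).trans hP) hsn

theorem exists_eq_add_single_of_ne_zero {s : I →₀ ℕ} (hs : s ≠ 0) :
    ∃ t i, s = t + Finsupp.single i 1 := by
  obtain ⟨i, hi⟩ := Finsupp.ne_iff.mp hs
  obtain ⟨t, ht⟩ := exists_add_of_le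
    (Finsupp.single_le_iff.mpr (Nat.one_le_iff_ne_zero.mpr hi) : Finsupp.single i 1 ≤ s)
  exact ⟨t, i, ht.trans (add_comm _ _)⟩

end Shift

section CharZero

variable {I L : Type*} [CommRing L] [IsDomain L] [CharZero L]

theorem totalDegree_le_succ_of_forall_pderiv {P : MvPolynomial I L} {n : ℕ}
    (h : ∀ i, (pderiv i P).totalDegree ≤ n) : P.totalDegree ≤ n + 1 := by
  refine Finset.sup_le fun s hs => ?_
  rcases eq_or_ne s 0 with rfl | hs0
  · simp
  obtain ⟨t, i, rfl⟩ := exists_eq_add_single_of_ne_zero hs0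
  have ht : t ∈ (pderiv i P).support := by
    rw [mem_support_iff, coeff_pderiv]
    exact mul_ne_zero (mem_support_iff.mp hs) (Nat.cast_add_one_ne_zero _)
  have hle : t.degree ≤ n := (le_totalDegree ht).trans (h i)
  change (t + Finsupp.single i 1).degree ≤ n + 1
  rw [map_add, Finsupp.degree_single]
  omega

theorem coeff_shiftEndo_of_totalDegree_le (σ : L →+* L) (b : I → L) {s : I →₀ ℕ}
    {P : MvPolynomial I L} (hP : P.totalDegree ≤ s.degree) :
    coeff s (shiftEndo σ b P) = σ (coeff s P) := by
  obtain ⟨n, hn⟩ : ∃ n, s.degree = n := ⟨_, rfl⟩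
  induction n generalizing s P with
  | zero =>
    obtain rfl : s = 0 := (Finsupp.degree_eq_zero_iff s).mp hn
    rw [totalDegree_eq_zero_iff_eq_C.mp (Nat.le_zero.mp (hP.trans_eq hn))]
    simp
  | succ n ih =>
    obtain ⟨t, i, rfl⟩ := exists_eq_add_single_of_ne_zero (s := s) (by rintro rfl; simp at hn)
    rw [map_add, Finsupp.degree_single] at hP hn
    have h := ih (P := pderiv i P) (s := t) ((totalDegree_pderiv_le i P).trans (by omega))
      (by omega)
    rw [← pderiv_shiftEndo, coeff_pderiv, coeff_pderiv, map_mul, map_add, map_natCast,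
      map_one] at h
    exact mul_right_cancel₀ (Nat.cast_add_one_ne_zero _) h

theorem totalDegree_shiftEndo_le (σ : L →+* L) (b : I → L) (P : MvPolynomial I L) :
    (shiftEndo σ b P).totalDegree ≤ P.totalDegree := by
  refine Finset.sup_le fun s hs => ?_
  by_contra! h
  change P.totalDegree < s.degree at h
  rw [mem_support_iff, coeff_shiftEndo_of_totalDegree_le σ b h.le,
    coeff_eq_zero_of_totalDegree_lt h, map_zero] at hs
  exact hs rfl

theorem homogeneousComponent_shiftEndo (σ : L →+* L) (b : I → L) {P : MvPolynomial I L} {n : ℕ}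
    (hP : P.totalDegree ≤ n) :
    homogeneousComponent n (shiftEndo σ b P) = map σ (homogeneousComponent n P) := by
  ext s
  rw [coeff_map, coeff_homogeneousComponent, coeff_homogeneousComponent]
  split_ifs with hs
  · exact coeff_shiftEndo_of_totalDegree_le σ b (hP.trans hs.ge)
  · exact (map_zero σ).symm

theorem exists_affine_invariant {σ : L →+* L} {b : I → L}
    (h : ∃ P : MvPolynomial I L, P.totalDegree ≠ 0 ∧ shiftEndo σ b P = P) :
    ∃ (c : I →₀ L) (a : L), c ≠ 0 ∧ (∀ i, σ (c i) = c i) ∧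
      shiftEndo σ b (Finsupp.linearCombination L X c + C a) =
        Finsupp.linearCombination L X c + C a := by
  obtain ⟨P, ⟨hP, hinv⟩, hmin⟩ := (InvImage.wf (fun P : MvPolynomial I L => P.totalDegree)
    wellFounded_lt).has_min {P | P.totalDegree ≠ 0 ∧ shiftEndo σ b P = P} h
  have hpderiv : ∀ i, (pderiv i P).totalDegree ≤ 0 := by
    refine fun i => Nat.le_zero.mpr (by_contra fun hne => ?_)
    refine hmin (pderiv i P) ⟨hne, by rw [← pderiv_shiftEndo, hinv]⟩ ?_
    exact (totalDegree_pderiv_le i P).trans_lt (Nat.sub_one_lt hP)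
  have hdeg : P.totalDegree ≤ 1 := totalDegree_le_succ_of_forall_pderiv hpderiv
  obtain ⟨c, a, rfl⟩ := exists_eq_linearCombination_X_add_C hdeg
  refine ⟨c, a, by rintro rfl; simp at hP, fun i => ?_, hinv⟩
  classical
  have hcoeff : coeff (Finsupp.single i 1) (Finsupp.linearCombination L X c + C a) = c i := by
    simp [Finsupp.linearCombination_apply, Finsupp.sum, coeff_sum, coeff_C, coeff_X,
      Finsupp.single_left_inj, eq_comm]
  have h := coeff_shiftEndo_of_totalDegree_le σ b (s := Finsupp.single i 1)
    (hdeg.trans_eq (Finsupp.degree_single i 1).symm)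
  rwa [hinv, hcoeff, eq_comm] at h

end CharZero

section Dependence

variable {I L : Type*} [Field L] [CharZero L]

theorem exists_invariant_of_ideal {σ : L →+* L} {b : I → L} {J : Ideal (MvPolynomial I L)}
    (hJ : J ≠ ⊤) (hJ0 : J ≠ ⊥) (hst : ∀ P ∈ J, shiftEndo σ b P ∈ J) :
    ∃ P : MvPolynomial I L, P.totalDegree ≠ 0 ∧ shiftEndo σ b P = P := by
  obtain ⟨P, ⟨hPJ, hP⟩, hmin⟩ := (InvImage.wf (fun P : MvPolynomial I L => P.totalDegree)
    wellFounded_lt).has_min {P | P ∈ J ∧ P ≠ 0} (J.ne_bot_iff.mp hJ0)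
  set n := P.totalDegree with hn
  have eq_zero_of_lt : ∀ Q ∈ J, Q.totalDegree < n → Q = 0 := fun Q hQ hlt =>
    by_contra fun hne => hmin Q ⟨hQ, hne⟩ hlt
  have hn0 : n ≠ 0 := fun h0 => by
    rw [totalDegree_eq_zero_iff_eq_C.mp (hn.symm.trans h0)] at hPJ hP
    exact hJ (J.eq_top_of_isUnit_mem hPJ ((isUnit_iff_ne_zero.mpr (ne_zero_of_map hP)).map C))
  let W : Submodule L (MvPolynomial I L) :=
    (J.restrictScalars L ⊓ restrictTotalDegree I L n).map (homogeneousComponent n)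
  have hW : W ≠ ⊥ := by
    refine W.ne_bot_iff.mpr ⟨_, ⟨P, ⟨hPJ, (mem_restrictTotalDegree I n P).mpr le_rfl⟩, rfl⟩, ?_⟩
    exact fun h => (totalDegree_lt_of_homogeneousComponent_eq_zero hn0 le_rfl h).ne hn
  have hσW : ∀ A ∈ W, map σ A ∈ W := by
    rintro _ ⟨Q, ⟨hQJ, hQn⟩, rfl⟩
    have hQn := (mem_restrictTotalDegree I n Q).mp hQn
    rw [← homogeneousComponent_shiftEndo σ b hQn]
    exact ⟨_, ⟨hst Q hQJ, (mem_restrictTotalDegree I n _).mpr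
      ((totalDegree_shiftEndo_le σ b Q).trans hQn)⟩, rfl⟩
  obtain ⟨_, ⟨Q, ⟨hQJ, hQn⟩, rfl⟩, hQ, hfix⟩ := exists_map_eq_self_of_map_mem hW hσW
  have hQn := (mem_restrictTotalDegree I n Q).mp hQn
  refine ⟨Q, fun h0 => hQ ?_, sub_eq_zero.mp (eq_zero_of_lt _ (J.sub_mem (hst Q hQJ) hQJ) ?_)⟩
  · rw [eq_zero_of_lt Q hQJ (h0 ▸ Nat.pos_of_ne_zero hn0), map_zero]
  · refine totalDegree_lt_of_homogeneousComponent_eq_zero hn0 ((totalDegree_sub _ _).trans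
      (max_le ((totalDegree_shiftEndo_le σ b Q).trans hQn) hQn)) ?_
    rw [map_sub, homogeneousComponent_shiftEndo σ b hQn, hfix, sub_self]

theorem exists_linear_invariant {F : Type*} [CommRing F] [Nontrivial F] [Algebra L F] {σ : L →+* L}
    {φ : F →+* F} (hφ : ∀ a, φ (algebraMap L F a) = algebraMap L F (σ a)) {x : I → F} {b : I → L}
    (hx : ∀ i, φ (x i) = x i + algebraMap L F (b i)) (hdep : ¬ AlgebraicIndependent L x) :
    ∃ (c : I →₀ L) (a : L), c ≠ 0 ∧ (∀ i, σ (c i) = c i) ∧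
      φ (Finsupp.linearCombination L x c + algebraMap L F a) =
        Finsupp.linearCombination L x c + algebraMap L F a := by
  let J : Ideal (MvPolynomial I L) := RingHom.ker (aeval x : MvPolynomial I L →ₐ[L] F)
  have hbot : J ≠ ⊥ := fun h => hdep ((RingHom.injective_iff_ker_eq_bot _).mpr h)
  have hst : ∀ P ∈ J, shiftEndo σ b P ∈ J := fun P hP => by
    rw [RingHom.mem_ker] at hP ⊢
    rw [aeval_shiftEndo hφ hx, hP, map_zero]
  obtain ⟨c, a, hc, hσ, hinv⟩ :=
    exists_affine_invariant (exists_invariant_of_ideal (RingHom.ker_ne_top _) hbot hst)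
  have haeval : aeval x (Finsupp.linearCombination L X c + C a) =
      Finsupp.linearCombination L x c + algebraMap L F a := by
    simp [Finsupp.linearCombination_apply, Finsupp.sum, Algebra.smul_def]
  exact ⟨c, a, hc, hσ, by rw [← haeval, ← aeval_shiftEndo hφ hx, hinv]⟩

end Dependence

end AffineInvariants

section DifferentialFields

open IntermediateField

variable {K F : Type*} [Field K] [Field F] [Algebra K F]

theorem diffTranscendental_iff_algebraicIndependent {D : F → F} {f : F} :
    DiffTranscendental (algebraMap K F) D f ↔ AlgebraicIndependent K fun i : ℕ => D^[i] f := by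
  refine ⟨fun h => algebraicIndependent_of_finite_type fun t ht => ?_, ?_⟩
  · obtain ⟨n, hn⟩ := ht.bddAbove
    have hFin : AlgebraicIndependent K fun i : Fin (n + 1) => D^[i] f :=
      algebraicIndependent_iff.mpr fun P hP => by_contra fun hP0 => h ⟨n, P, hP0, hP⟩
    exact hFin.comp (fun i : t => ⟨i, Nat.lt_succ_of_le (hn i.2)⟩)
      fun i j hij => Subtype.ext (congrArg Fin.val hij)
  · rintro h ⟨n, P, hP0, hP⟩
    exact hP0 (algebraicIndependent_iff.mp (h.comp _ Fin.val_injective) P hP)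

theorem map_mem_of_mem_adjoin {φ : F →+* F} {s : Set F} {E : IntermediateField K F}
    (hK : ∀ a : K, φ (algebraMap K F a) ∈ E) (hs : ∀ x ∈ s, φ x ∈ E) {x : F}
    (hx : x ∈ adjoin K s) : φ x ∈ E := by
  let E' : IntermediateField K F := { E.toSubfield.comap φ with algebraMap_mem' := hK }
  exact (adjoin_le_iff (T := E')).mpr hs hx

theorem derivation_mem_of_mem_adjoin {D : Derivation ℤ F F} {s : Set F} {E : IntermediateField K F}
    (hle : adjoin K s ≤ E) (hK : ∀ a : K, D (algebraMap K F a) ∈ E) (hs : ∀ x ∈ s, D x ∈ E) {x : F}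
    (hx : x ∈ adjoin K s) : D x ∈ E := by
  induction hx using adjoin_induction with
  | mem x hx => exact hs x hx
  | algebraMap x => exact hK x
  | add x y _ _ hx hy => rw [map_add]; exact E.add_mem hx hy
  | inv x h hx =>
    rw [Derivation.leibniz_inv, smul_eq_mul, neg_mul]
    exact E.neg_mem (E.mul_mem (pow_mem (E.inv_mem (hle h)) 2) hx)
  | mul x y h h' hx hy =>
    rw [Derivation.leibniz, smul_eq_mul, smul_eq_mul]
    exact E.add_mem (E.mul_mem (hle h) hy) (E.mul_mem (hle h') hx)

theorem derivation_mem_of_isAlgebraic [CharZero K] {D : Derivation ℤ F F}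
    {E E' : IntermediateField K F} (hE : E ≤ E') (hD : ∀ x ∈ E, D x ∈ E') {α : F} (hα : α ∈ E')
    (halg : IsAlgebraic E α) : D α ∈ E' := by
  have haeval (p : Polynomial E) : Polynomial.aeval α p ∈ E' := by
    rw [Polynomial.aeval_eq_sum_range]
    exact sum_mem fun i _ => E'.mul_mem (hE (p.coeff i).2) (pow_mem hα i)
  have hchain (p : Polynomial E) :
      D (Polynomial.aeval α p) - Polynomial.aeval α p.derivative * D α ∈ E' := by
    induction p using Polynomial.induction_on' with
    | add p q hp hq =>
      convert E'.add_mem hp hq using 1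
      simp only [map_add]
      ring
    | monomial n a =>
      convert E'.mul_mem (hD a a.2) (pow_mem hα n) using 1
      simp only [Polynomial.aeval_monomial, Polynomial.derivative_monomial, Derivation.leibniz,
        Derivation.leibniz_pow, smul_eq_mul, map_mul, map_natCast, nsmul_eq_mul,
        IntermediateField.algebraMap_apply]
      ring
  have hne : Polynomial.aeval α (minpoly E α).derivative ≠ 0 :=
    (minpoly.irreducible halg.isIntegral).separable.aeval_derivative_ne_zero (minpoly.aeval E α)
  have h := E'.mul_mem (E'.inv_mem (haeval (minpoly E α).derivative))
    (E'.neg_mem (hchain (minpoly E α)))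
  rwa [minpoly.aeval, map_zero, zero_sub, neg_neg, inv_mul_cancel_left₀ hne] at h

theorem exists_isAlgebraic_adjoin_image_Iio {u : ℕ → F} (hu : ¬ AlgebraicIndependent K u) :
    ∃ n, IsAlgebraic (adjoin K (u '' Set.Iio n)) (u n) := by
  contrapose! hu
  have hIio : ∀ n, AlgebraicIndepOn K u (Set.Iio n) := by
    intro n
    induction n with
    | zero =>
      have : IsEmpty (Set.Iio 0 : Set ℕ) := by simp
      exact algebraicIndependent_empty_type_iff.mpr (algebraMap K F).injective
    | succ n ih =>
      rw [show Set.Iio (n + 1) = insert n (Set.Iio n) from Order.Iio_succ_eq_insert n]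
      exact ih.insert (transcendental_adjoin_iff.mp (hu n))
  refine algebraicIndependent_of_finite_type fun t ht => ?_
  obtain ⟨n, hn⟩ := ht.bddAbove
  exact (hIio (n + 1)).mono fun i hi => Nat.lt_succ_of_le (hn hi)

theorem exists_fg_differential_field [CharZero K] {D : Derivation ℤ F F}
    (hDK : ∀ a : K, D (algebraMap K F a) ∈ (⊥ : IntermediateField K F)) {f : F}
    (hf : ¬ AlgebraicIndependent K fun i : ℕ => D^[i] f) :
    ∃ E : IntermediateField K F, E.FG ∧ (∀ x ∈ E, D x ∈ E) ∧ f ∈ E := by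
  set u : ℕ → F := fun i => D^[i] f
  have hDu : ∀ i, D (u i) = u (i + 1) := fun i => (Function.iterate_succ_apply' D i f).symm
  obtain ⟨n, hn⟩ := exists_isAlgebraic_adjoin_image_Iio hf
  set E := adjoin K (u '' Set.Iio n)
  set E' := adjoin K (u '' Set.Iio (n + 1))
  have hu : ∀ i < n + 1, u i ∈ E' := fun i hi => subset_adjoin _ _ ⟨i, hi, rfl⟩
  have hle : E ≤ E' := adjoin.mono _ _ _ (Set.image_mono (Set.Iio_subset_Iio n.le_succ))
  have hDK' (a : K) : D (algebraMap K F a) ∈ E' := bot_le (a := E') (hDK a)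
  have hDE : ∀ x ∈ E, D x ∈ E' := fun x hx => by
    refine derivation_mem_of_mem_adjoin hle hDK' ?_ hx
    rintro _ ⟨i, hi, rfl⟩
    exact hDu i ▸ hu (i + 1) (Nat.succ_lt_succ hi)
  have hDn : D (u n) ∈ E' := derivation_mem_of_isAlgebraic hle hDE (hu n n.lt_succ_self) hn
  refine ⟨E', fg_adjoin_of_finite ((Set.finite_Iio _).image _), fun x hx => ?_, hu 0 n.succ_pos⟩
  refine derivation_mem_of_mem_adjoin le_rfl hDK' ?_ hx
  rintro _ ⟨i, hi, rfl⟩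
  rcases (Nat.lt_succ_iff.mp hi).lt_or_eq with h | rfl
  · exact hDu i ▸ hu (i + 1) (Nat.succ_lt_succ h)
  · exact hDn

theorem iterate_mem {D : F → F} {E : IntermediateField K F} (hD : ∀ x ∈ E, D x ∈ E) {f : F}
    (hf : f ∈ E) (i : ℕ) : D^[i] f ∈ E :=
  Set.MapsTo.iterate (f := D) (s := (E : Set F)) hD i hf

theorem not_algebraicIndependent_of_mem_finTrdeg {E : IntermediateField K F} [FinTrdeg K E]
    {I : Type*} [Infinite I] {x : I → F} (hx : ∀ i, x i ∈ E) : ¬ AlgebraicIndependent K x :=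
  fun h => (finite_of_algebraicIndependent (x := fun i => (⟨x i, hx i⟩ : E))
    (.of_comp E.val h)).false

theorem finTrdeg_of_fg {E : IntermediateField K F} (hE : E.FG) : FinTrdeg K E :=
  have := essFiniteType_iff.mpr hE
  inferInstance

theorem fg_adjoin_of_fg {L M : IntermediateField K F} (hM : M.FG) : (adjoin L (M : Set F)).FG := by
  obtain ⟨S, rfl⟩ := hM
  refine ⟨S, le_antisymm (adjoin.mono _ _ _ (subset_adjoin K _)) (adjoin_le_iff.mpr ?_)⟩
  exact (adjoin_le_iff (T := (adjoin L (S : Set F)).restrictScalars K)).mpr (subset_adjoin L _)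

theorem algebraicIndependent_iterate_of_fg [CharZero K] {D : Derivation ℤ F F}
    {M : IntermediateField K F} (hM : M.FG) (hDM : ∀ x ∈ M, D x ∈ M) {Ψ : F}
    (hΨ : AlgebraicIndependent K fun i : ℕ => D^[i] Ψ) :
    AlgebraicIndependent M fun i : ℕ => D^[i] Ψ := by
  by_contra h
  obtain ⟨E, hE, hDE, hΨE⟩ := exists_fg_differential_field (K := M)
    (fun a => mem_bot.mpr ⟨⟨D a, hDM a a.2⟩, rfl⟩) h
  have := finTrdeg_of_fg hM
  have := finTrdeg_of_fg hE
  have : FinTrdeg K (E.restrictScalars K) := FinTrdeg.trans K M E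
  exact not_algebraicIndependent_of_mem_finTrdeg (E := E.restrictScalars K)
    (fun i => iterate_mem hDE hΨE i) hΨ

end DifferentialFields

section Jets

open MvPolynomial

/-- The derivation of `ℤ[Y₀, Y₁, …, Z₀, Z₁, …]` with `Yᵢ ↦ Yᵢ₊₁` and `Zᵢ ↦ Zᵢ₊₁`. The variables
`Yᵢ` are indexed by the left summand, the `Zᵢ` by the right one. -/
def jetDeriv : Derivation ℤ (MvPolynomial (ℕ ⊕ ℕ) ℤ) (MvPolynomial (ℕ ⊕ ℕ) ℤ) :=
  mkDerivation ℤ (Sum.elim (fun i => X (Sum.inl (i + 1))) fun i => X (Sum.inr (i + 1)))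

/-- The polynomial that expresses `(Ψ D)ⁿ f` in terms of `Yᵢ = Dⁱ Ψ` and `Zᵢ = Dⁱ f`. -/
def jet (n : ℕ) : MvPolynomial (ℕ ⊕ ℕ) ℤ :=
  (fun P => X (Sum.inl 0) * jetDeriv P)^[n] (X (Sum.inr 0))

theorem jet_zero : jet 0 = X (Sum.inr 0) := rfl

theorem jet_succ (n : ℕ) : jet (n + 1) = X (Sum.inl 0) * jetDeriv (jet n) :=
  Function.iterate_succ_apply' _ n _

@[simp]
theorem jetDeriv_X_inl (i : ℕ) : jetDeriv (X (Sum.inl i)) = X (Sum.inl (i + 1)) :=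
  mkDerivation_X _ _ _

@[simp]
theorem jetDeriv_X_inr (i : ℕ) : jetDeriv (X (Sum.inr i)) = X (Sum.inr (i + 1)) :=
  mkDerivation_X _ _ _

theorem derivation_aeval_jet {F : Type*} [CommRing F] (D : Derivation ℤ F F) (Ψ f : F)
    (P : MvPolynomial (ℕ ⊕ ℕ) ℤ) :
    D (aeval (Sum.elim (fun i => D^[i] Ψ) fun i => D^[i] f) P) =
      aeval (Sum.elim (fun i => D^[i] Ψ) fun i => D^[i] f) (jetDeriv P) := by
  induction P using MvPolynomial.induction_on with
  | C a => simp [jetDeriv]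
  | add p q hp hq => simp [hp, hq]
  | mul_X p i hp =>
    rcases i with i | i <;> simp [Derivation.leibniz, hp, Function.iterate_succ_apply' D]

theorem aeval_jet {F : Type*} [CommRing F] (D : Derivation ℤ F F) (Ψ f : F) (n : ℕ) :
    aeval (Sum.elim (fun i => D^[i] Ψ) fun i => D^[i] f) (jet n) = (Ψ • D)^[n] f := by
  induction n with
  | zero => simp [jet_zero]
  | succ n ih =>
    rw [Function.iterate_succ_apply', ← ih, jet_succ, map_mul, ← derivation_aeval_jet]
    simp

theorem commutator_pderiv_inl_succ_jetDeriv (j : ℕ) :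
    ⁅(pderiv (Sum.inl (j + 1)) : Derivation ℤ (MvPolynomial (ℕ ⊕ ℕ) ℤ) _), jetDeriv⁆ =
      pderiv (Sum.inl j) := by
  classical
  ext1 i
  rcases i with i | i <;>
    simp [Derivation.commutator_apply, pderiv_X, Pi.single_apply, apply_ite jetDeriv]

theorem pderiv_inl_succ_jetDeriv (j : ℕ) (P : MvPolynomial (ℕ ⊕ ℕ) ℤ) :
    pderiv (Sum.inl (j + 1)) (jetDeriv P) =
      jetDeriv (pderiv (Sum.inl (j + 1)) P) + pderiv (Sum.inl j) P := by
  have h := Derivation.congr_fun (commutator_pderiv_inl_succ_jetDeriv j) P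
  rwa [Derivation.commutator_apply, sub_eq_iff_eq_add'] at h

theorem pderiv_inl_jet_of_le {n j : ℕ} (h : n ≤ j) : pderiv (Sum.inl j) (jet n) = 0 := by
  induction n generalizing j with
  | zero => exact pderiv_X_of_ne Sum.inr_ne_inl
  | succ n ih =>
    obtain ⟨j, rfl⟩ : ∃ i, j = i + 1 := Nat.exists_eq_add_one.mpr (by omega)
    rw [jet_succ, pderiv_mul, pderiv_inl_succ_jetDeriv, ih (by omega), ih (by omega),
      pderiv_X_of_ne (by simp)]
    simp

theorem pderiv_inl_jet_succ (n : ℕ) :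
    pderiv (Sum.inl n) (jet (n + 1)) = X (Sum.inl 0) ^ n * X (Sum.inr 1) := by
  induction n with
  | zero => simp [jet_succ, jet_zero]
  | succ n ih =>
    rw [jet_succ, pderiv_mul, pderiv_inl_succ_jetDeriv, ih, pderiv_inl_jet_of_le le_rfl,
      pderiv_X_of_ne (by simp), map_zero, zero_mul, zero_add, zero_add, pow_succ']
    ring

/-- The specialization of the variables `Zᵢ` to elements of a ring. -/
def jetSpecialize {M : Type*} [CommRing M] (z : ℕ → M) :
    MvPolynomial (ℕ ⊕ ℕ) ℤ →ₐ[ℤ] MvPolynomial ℕ M :=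
  aeval (Sum.elim X (C ∘ z))

theorem pderiv_jetSpecialize {M : Type*} [CommRing M] (z : ℕ → M) (j : ℕ)
    (P : MvPolynomial (ℕ ⊕ ℕ) ℤ) :
    pderiv j (jetSpecialize z P) = jetSpecialize z (pderiv (Sum.inl j) P) :=
  (aeval_sumElim_pderiv_inl P z j).symm

theorem aeval_jetSpecialize {M F : Type*} [CommRing M] [CommRing F] [Algebra M F] (z : ℕ → M)
    (y : ℕ → F) (P : MvPolynomial (ℕ ⊕ ℕ) ℤ) :
    aeval y (jetSpecialize z P) = aeval (Sum.elim y fun i => algebraMap M F (z i)) P := by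
  induction P using MvPolynomial.induction_on with
  | C a => simp [jetSpecialize]
  | add p q hp hq => simp [hp, hq]
  | mul_X p i hp => rcases i with i | i <;> simp_all [jetSpecialize]

end Jets

section Descent

open MvPolynomial IntermediateField

/- Project the coefficients of `G` to `K` by a `K`-linear retraction of `K → M`. -/
theorem mem_range_map_of_map_mul_eq_map {K M I : Type*} [Field K] [CommRing M] [IsDomain M]
    [Algebra K M] {p q : MvPolynomial I K} {G : MvPolynomial I M} (hp : p ≠ 0)
    (h : map (algebraMap K M) p * G = map (algebraMap K M) q) :
    ∃ Q, map (algebraMap K M) Q = G := by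
  classical
  obtain ⟨π, hπ⟩ := (Algebra.linearMap K M).exists_leftInverse_of_injective
    (LinearMap.ker_eq_bot.mpr (algebraMap K M).injective)
  have hπK (a : K) : π (algebraMap K M a) = a := LinearMap.congr_fun hπ a
  let Q : MvPolynomial I K := ∑ t ∈ G.support, monomial t (π (coeff t G))
  have hQ (t) : coeff t Q = π (coeff t G) := by
    simp only [Q, coeff_sum, coeff_monomial, Finset.sum_ite_eq', mem_support_iff]
    split_ifs with h0
    · rfl
    · rw [not_not.mp h0, map_zero]
  have hpQ : p * Q = q := by
    ext t
    have ht := congrArg (fun P => π (coeff t P)) h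
    simp only [coeff_mul, coeff_map, map_sum, hπK, ← Algebra.smul_def, map_smul] at ht
    simp only [coeff_mul, hQ, ← ht, smul_eq_mul]
  have hp' : map (algebraMap K M) p ≠ 0 :=
    (map_ne_zero_iff _ (map_injective _ (algebraMap K M).injective)).mpr hp
  exact ⟨Q, mul_left_cancel₀ hp' (by rw [h, ← hpQ, map_mul])⟩

variable {K F : Type*} [Field K] [Field F] [Algebra K F]

theorem mem_range_map_of_aeval_mem_adjoin {M : IntermediateField K F} {I : Type*} {y : I → F}
    (hy : AlgebraicIndependent M y) {G : MvPolynomial I M}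
    (hG : aeval y G ∈ adjoin K (Set.range y)) : ∃ Q, map (algebraMap K M) Q = G := by
  obtain ⟨q, p, hqp⟩ := (mem_adjoin_range_iff K _ _).mp hG
  by_cases hp : aeval y p = 0
  · rw [hp, div_zero] at hqp
    exact ⟨0, by rw [map_zero, algebraicIndependent_iff.mp hy G hqp]⟩
  · refine mem_range_map_of_map_mul_eq_map (p := p) (q := q) (by rintro rfl; simp at hp) (hy ?_)
    change aeval y _ = aeval y _
    rw [map_mul, aeval_map_algebraMap, aeval_map_algebraMap, hqp, mul_div_cancel₀ _ hp]

theorem mem_bot_of_map_eq_monomial {M : IntermediateField K F} {I : Type*} {Q : MvPolynomial I K}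
    {e : I →₀ ℕ} {c : K} (hc : c ≠ 0) {w : M}
    (h : map (algebraMap K M) Q = monomial e (algebraMap K M c * w)) :
    (w : F) ∈ (⊥ : IntermediateField K F) := by
  classical
  have he := congrArg (coeff e) h
  rw [coeff_map, coeff_monomial, if_pos rfl] at he
  have hw : algebraMap K F (coeff e Q) = algebraMap K F c * w := congrArg (algebraMap M F) he
  refine mem_bot.mpr ⟨c⁻¹ * coeff e Q, ?_⟩
  rw [map_mul, hw, ← mul_assoc, ← map_mul, inv_mul_cancel₀ hc, map_one, one_mul]

theorem pderiv_sum_jetSpecialize {M : Type*} [CommRing M] (z c : ℕ → M) {s : Finset ℕ} {m : ℕ}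
    (hm : m + 1 ∈ s) (hs : ∀ i ∈ s, i ≤ m + 1) :
    pderiv m (∑ i ∈ s, C (c i) * jetSpecialize z (jet i)) =
      monomial (Finsupp.single 0 m) (c (m + 1) * z 1) := by
  have hvanish : ∀ i ∈ s, i ≠ m + 1 → pderiv m (C (c i) * jetSpecialize z (jet i)) = 0 :=
    fun i hi hne => by
      have := hs i hi
      rw [pderiv_C_mul, pderiv_jetSpecialize, pderiv_inl_jet_of_le (by omega), map_zero, mul_zero]
  rw [map_sum, Finset.sum_eq_single_of_mem _ hm hvanish, pderiv_C_mul, pderiv_jetSpecialize,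
    pderiv_inl_jet_succ]
  simp [jetSpecialize, monomial_eq]
  ring

theorem mem_bot_or_derivation_mem_bot_of_sum_mem [CharZero K] {D : Derivation ℤ F F}
    {M : IntermediateField K F} (hDM : ∀ x ∈ M, D x ∈ M) {f Ψ : F} (hf : f ∈ M)
    (hΨ : AlgebraicIndependent M fun i : ℕ => D^[i] Ψ) {s : Finset ℕ} (hs : s.Nonempty) {c : ℕ → K}
    (hc : ∀ i ∈ s, c i ≠ 0)
    (hsum : ∑ i ∈ s, algebraMap K F (c i) * (Ψ • D)^[i] f ∈
      adjoin K (Set.range fun i : ℕ => D^[i] Ψ)) :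
    f ∈ (⊥ : IntermediateField K F) ∨ D f ∈ (⊥ : IntermediateField K F) := by
  let z (i : ℕ) : M := ⟨D^[i] f, iterate_mem hDM hf i⟩
  set G := ∑ i ∈ s, C (algebraMap K M (c i)) * jetSpecialize z (jet i) with hG
  have hGsum : aeval (fun i => D^[i] Ψ) G = ∑ i ∈ s, algebraMap K F (c i) * (Ψ • D)^[i] f := by
    simp only [hG, map_sum, map_mul, aeval_jetSpecialize, aeval_C]
    exact Finset.sum_congr rfl fun i _ => congrArg _ (aeval_jet D Ψ f i)
  obtain ⟨Q, hQ⟩ := mem_range_map_of_aeval_mem_adjoin hΨ (hGsum ▸ hsum)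
  have hmax : s.max' hs ∈ s := s.max'_mem hs
  rcases hN : s.max' hs with _ | m
  · have hs0 : s = {0} :=
      Finset.eq_singleton_iff_nonempty_unique_mem.mpr ⟨hs, fun i hi =>
        Nat.le_zero.mp ((s.le_max' i hi).trans_eq hN)⟩
    refine .inl (mem_bot_of_map_eq_monomial (w := z 0) (hc 0 (hN ▸ hmax)) (e := 0) (hQ.trans ?_))
    simp [hG, hs0, jet_zero, jetSpecialize]
  · refine .inr (mem_bot_of_map_eq_monomial (w := z 1) (hc (m + 1) (hN ▸ hmax))
      (Q := pderiv m Q) (e := Finsupp.single 0 m) ?_)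
    rw [← pderiv_map, hQ, hG]
    exact pderiv_sum_jetSpecialize z _ (hN ▸ hmax) fun i hi => (s.le_max' i hi).trans_eq hN

theorem derivation_mem_adjoin_range_iterate {D : Derivation ℤ F F}
    (hDK : ∀ a : K, D (algebraMap K F a) ∈ (⊥ : IntermediateField K F)) {Ψ x : F}
    (hx : x ∈ adjoin K (Set.range fun i : ℕ => D^[i] Ψ)) :
    D x ∈ adjoin K (Set.range fun i : ℕ => D^[i] Ψ) := by
  refine derivation_mem_of_mem_adjoin le_rfl (fun a => bot_le (a := adjoin K _) (hDK a)) ?_ hx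
  rintro _ ⟨i, rfl⟩
  exact subset_adjoin _ _ ⟨i + 1, Function.iterate_succ_apply' D i Ψ⟩

theorem map_mem_adjoin_range_iterate {D : Derivation ℤ F F} {φ : F →+* F} {r : K} {Ψ : F}
    (hDK : ∀ a : K, D (algebraMap K F a) ∈ (⊥ : IntermediateField K F))
    (hφK : ∀ a : K, φ (algebraMap K F a) ∈ (⊥ : IntermediateField K F)) (hr : r ≠ 0)
    (hchain : ∀ x, D (φ x) = algebraMap K F r * φ (D x)) (hφΨ : φ Ψ = algebraMap K F r * Ψ)
    {x : F} (hx : x ∈ adjoin K (Set.range fun i : ℕ => D^[i] Ψ)) :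
    φ x ∈ adjoin K (Set.range fun i : ℕ => D^[i] Ψ) := by
  set L := adjoin K (Set.range fun i : ℕ => D^[i] Ψ)
  refine map_mem_of_mem_adjoin (fun a => bot_le (a := L) (hφK a)) ?_ hx
  rintro _ ⟨i, rfl⟩
  induction i with
  | zero => exact hφΨ ▸ L.mul_mem (L.algebraMap_mem r) (subset_adjoin _ _ ⟨0, rfl⟩)
  | succ i ih =>
    have h : φ (D^[i + 1] Ψ) = algebraMap K F r⁻¹ * D (φ (D^[i] Ψ)) := by
      rw [Function.iterate_succ_apply', hchain, ← mul_assoc, ← map_mul, inv_mul_cancel₀ hr,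
        map_one, one_mul]
    exact h ▸ L.mul_mem (L.algebraMap_mem _) (derivation_mem_adjoin_range_iterate hDK ih)

theorem not_algebraicIndependent_iterate_smul {D : Derivation ℤ F F} {L M : IntermediateField K F}
    (hDL : ∀ x ∈ L, D x ∈ L) (hM : M.FG) (hDM : ∀ x ∈ M, D x ∈ M) {f Ψ : F} (hf : f ∈ M)
    (hΨ : Ψ ∈ L) : ¬ AlgebraicIndependent L fun i : ℕ => (Ψ • D)^[i] f := by
  set E := adjoin L (M : Set F)
  have hDE : ∀ x ∈ E, D x ∈ E := fun x hx =>
    derivation_mem_of_mem_adjoin (K := L) le_rfl (fun a => E.algebraMap_mem ⟨D a, hDL a a.2⟩)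
      (fun x hx => subset_adjoin L _ (hDM x hx)) hx
  have hδE : ∀ x ∈ E, (Ψ • D) x ∈ E := fun x hx =>
    E.mul_mem (E.algebraMap_mem ⟨Ψ, hΨ⟩) (hDE x hx)
  have := finTrdeg_of_fg (fg_adjoin_of_fg (L := L) hM)
  exact not_algebraicIndependent_of_mem_finTrdeg (iterate_mem hδE (subset_adjoin L _ hf))

theorem mem_bot_or_derivation_mem_bot [CharZero K] {D : Derivation ℤ F F} {φ : F →+* F} {r b : K}
    {f Ψ : F} (hDK : ∀ a : K, D (algebraMap K F a) ∈ (⊥ : IntermediateField K F))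
    (hφK : ∀ a : K, φ (algebraMap K F a) ∈ (⊥ : IntermediateField K F))
    (hfix : ∀ x, φ x = x → x ∈ (⊥ : IntermediateField K F))
    (hchain : ∀ x, D (φ x) = algebraMap K F r * φ (D x)) (hφΨ : φ Ψ = algebraMap K F r * Ψ)
    (hΨ : AlgebraicIndependent K fun i : ℕ => D^[i] Ψ) (hφf : φ f = f + algebraMap K F b)
    (hf : ¬ AlgebraicIndependent K fun i : ℕ => D^[i] f) :
    f ∈ (⊥ : IntermediateField K F) ∨ D f ∈ (⊥ : IntermediateField K F) := by
  have hr : r ≠ 0 := by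
    rintro rfl
    rw [map_zero, zero_mul, map_eq_zero] at hφΨ
    exact hΨ.ne_zero 0 hφΨ
  set L := adjoin K (Set.range fun i : ℕ => D^[i] Ψ)
  have hΨL : Ψ ∈ L := subset_adjoin _ _ ⟨0, rfl⟩
  have hDL : ∀ x ∈ L, D x ∈ L := fun x => derivation_mem_adjoin_range_iterate hDK
  have hδL : ∀ x ∈ L, (Ψ • D) x ∈ L := fun x hx => L.mul_mem hΨL (hDL x hx)
  let σ : L →+* L := φ.restrict L L fun x => map_mem_adjoin_range_iterate hDK hφK hr hchain hφΨ
  have hcomm : Function.Commute φ (Ψ • D : Derivation ℤ F F) := fun x => by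
    simp only [Derivation.smul_apply, smul_eq_mul, map_mul, hφΨ, hchain]
    ring
  obtain ⟨M, hM, hDM, hfM⟩ := exists_fg_differential_field hDK hf
  have hx (i : ℕ) : φ ((Ψ • D)^[i] f) = (Ψ • D)^[i] f +
      algebraMap L F ⟨(Ψ • D)^[i] (algebraMap K F b), iterate_mem hδL (L.algebraMap_mem b) i⟩ := by
    rw [hcomm.iterate_right i f, hφf]
    exact iterate_map_add (Ψ • D) i _ _
  obtain ⟨c, a, hc, hσc, hinv⟩ := exists_linear_invariant (σ := σ) (fun _ => rfl) hx
    (not_algebraicIndependent_iterate_smul hDL hM hDM hfM hΨL)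
  choose c' hc' using fun i => mem_bot.mp (hfix (c i) (congrArg Subtype.val (hσc i)))
  refine mem_bot_or_derivation_mem_bot_of_sum_mem hDM hfM
    (algebraicIndependent_iterate_of_fg hM hDM hΨ) (Finsupp.support_nonempty_iff.mpr hc) (c := c')
    (fun i hi h0 => Finsupp.mem_support_iff.mp hi (Subtype.ext ?_)) ?_
  · rw [← hc', h0, map_zero, ZeroMemClass.coe_zero]
  · have hsum := L.sub_mem (bot_le (a := L) (hfix _ hinv)) a.2
    rw [IntermediateField.algebraMap_apply, add_sub_cancel_right] at hsum
    simpa [Finsupp.linearCombination_apply, Finsupp.sum, hc', Algebra.smul_def] using hsum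

end Descent

section LocalizationDerivation

open scoped TensorProduct

/-- The additive derivations of a ring. The abbreviation fixes the `ℤ`-algebra structure: instance
search on `K[T]`, `K(T)` or `ℂ⟦t⟧` finds others, which are not reducibly equal to it. -/
abbrev RingDerivation (A : Type*) [CommRing A] : Type _ := Derivation ℤ A A

/-- The additive derivation underlying an `R`-linear derivation. -/
def RingDerivation.ofLinear {R A : Type*} [CommRing R] [CommRing A] [Algebra R A]
    (d : Derivation R A A) : RingDerivation A :=
  d.restrictScalars ℤ

namespace RingDerivation

theorem apply_mul {A : Type*} [CommRing A] (D : RingDerivation A) (x y : A) :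
    D (x * y) = x * D y + y * D x :=
  D.leibniz x y

variable {F : Type*} [Field F] (D : RingDerivation F)

theorem apply_div (x y : F) : D (x / y) = (D x * y - x * D y) / y ^ 2 := by
  rw [Derivation.leibniz_div D, smul_eq_mul, smul_eq_mul, smul_eq_mul, div_eq_inv_mul]
  ring

theorem apply_zpow (x : F) (n : ℤ) : D (x ^ n) = n * x ^ (n - 1) * D x := by
  rw [Derivation.leibniz_zpow D, zsmul_eq_mul, smul_eq_mul, mul_assoc]

/-- The logarithmic derivative `D x / x`, which is `0` at `x = 0`. -/
def logDeriv (x : F) : F := D x / x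

theorem logDeriv_mul {x y : F} (hx : x ≠ 0) (hy : y ≠ 0) :
    D.logDeriv (x * y) = D.logDeriv x + D.logDeriv y :=
  let : Differential F := ⟨D⟩
  Differential.logDeriv_mul x y hx hy

theorem logDeriv_div {x y : F} (hx : x ≠ 0) (hy : y ≠ 0) :
    D.logDeriv (x / y) = D.logDeriv x - D.logDeriv y :=
  let : Differential F := ⟨D⟩
  Differential.logDeriv_div x y hx hy

theorem logDeriv_zpow {x : F} (hx : x ≠ 0) (n : ℤ) : D.logDeriv (x ^ n) = n * D.logDeriv x := by
  rw [logDeriv, apply_zpow, logDeriv, zpow_sub_one₀ hx]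
  field_simp

end RingDerivation

/-- The extension of a derivation from a ring `A` to a localization of `A`. It comes from the
isomorphism of Kähler differentials `B ⊗ Ω[A] ≃ Ω[B]`. -/
def localizationDerivation {A : Type*} (B : Type*) [CommRing A] [CommRing B] [Algebra A B]
    (S : Submonoid A) [IsLocalization S B] (d : RingDerivation A) : RingDerivation B :=
  have : Algebra.FormallyEtale A B := .of_isLocalization S
  let dB : Derivation ℤ A B := (Algebra.linearMap A B).compDer d
  (dB.liftKaehlerDifferential.liftBaseChange B ∘ₗ
    (KaehlerDifferential.tensorKaehlerEquivOfFormallyEtale ℤ A B).symm.toLinearMap).compDer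
      (KaehlerDifferential.D ℤ B)

theorem localizationDerivation_algebraMap {A B : Type*} [CommRing A] [CommRing B] [Algebra A B]
    (S : Submonoid A) [IsLocalization S B] (d : RingDerivation A) (a : A) :
    localizationDerivation B S d (algebraMap A B a) = algebraMap A B (d a) := by
  have : Algebra.FormallyEtale A B := .of_isLocalization S
  have h : (KaehlerDifferential.tensorKaehlerEquivOfFormallyEtale ℤ A B).symm
      (KaehlerDifferential.D ℤ B (algebraMap A B a)) = 1 ⊗ₜ KaehlerDifferential.D ℤ A a := by
    simp [LinearEquiv.symm_apply_eq]
  simp [localizationDerivation, h]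

theorem derivation_map_eq_of_isFractionRing {A F E : Type*} [CommRing A] [Field F] [Algebra A F]
    [IsFractionRing A F] [Field E] {D : RingDerivation F} {D' : RingDerivation E} {φ : F →+* E}
    {r : E} (h : ∀ a : A, D' (φ (algebraMap A F a)) = r * φ (D (algebraMap A F a))) (x : F) :
    D' (φ x) = r * φ (D x) := by
  obtain ⟨a, b, -, rfl⟩ := IsFractionRing.div_surjective (A := A) x
  rw [map_div₀, D'.apply_div, D.apply_div, h, h]
  simp only [map_sub, map_mul, map_div₀, map_pow]
  ring

theorem derivation_map_ratFunc_eq {K E : Type*} [Field K] [Field E]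
    {D : RingDerivation (RatFunc K)} {D' : RingDerivation E} {φ : RatFunc K →+* E} {r : E}
    (hC : ∀ a, D' (φ (RatFunc.C a)) = r * φ (D (RatFunc.C a)))
    (hX : D' (φ RatFunc.X) = r * φ (D RatFunc.X)) (x : RatFunc K) : D' (φ x) = r * φ (D x) := by
  refine derivation_map_eq_of_isFractionRing (A := Polynomial K) (fun p => ?_) x
  induction p using Polynomial.induction_on' with
  | add p q hp hq => simp only [map_add, hp, hq, mul_add]
  | monomial n a =>
    rw [← Polynomial.C_mul_X_pow_eq_monomial, map_mul, map_pow, RatFunc.algebraMap_C,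
      RatFunc.algebraMap_X]
    simp only [map_mul, map_pow, Derivation.leibniz, Derivation.leibniz_pow, smul_eq_mul,
      nsmul_eq_mul, map_add, map_natCast, hC, hX]
    ring

theorem mem_subfield_ratFunc {K : Type*} [Field K] {S : Subfield (RatFunc K)}
    (hC : ∀ a, RatFunc.C a ∈ S) (hX : RatFunc.X ∈ S) (x : RatFunc K) : x ∈ S := by
  let S' : IntermediateField K (RatFunc K) := S.toIntermediateField hC
  have hle : IntermediateField.adjoin K {(RatFunc.X : RatFunc K)} ≤ S' :=
    IntermediateField.adjoin_simple_le_iff.mpr hX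
  exact hle (RatFunc.adjoin_X (K := K) ▸ IntermediateField.mem_top)

end LocalizationDerivation

section AdjoinDerivation

variable {K : Type*} [Field K]

/-- `polyDeriv δ s` as a derivation of `K[T]`. -/
def polyDerivation (δ : RingDerivation K) (s : K) : RingDerivation (Polynomial K) :=
  .ofLinear (PolynomialModule.equivPolynomialSelf.compDer δ.mapCoeffs) +
    .ofLinear (Polynomial.C s • Polynomial.derivative')

theorem polyDerivation_apply (δ : RingDerivation K) (s : K) (p : Polynomial K) :
    polyDerivation δ s p = polyDeriv δ s p := by
  refine congrArg (· + Polynomial.C s * p.derivative) (Polynomial.ext fun n => ?_)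
  change δ (p.coeff n) = _
  rw [Polynomial.sum, Polynomial.finsetSum_coeff]
  simp only [Polynomial.coeff_monomial, Finset.sum_ite_eq']
  split_ifs with h
  · rfl
  · rw [Polynomial.notMem_support_iff.mp h, map_zero]

/-- `ratDeriv δ s` as a derivation of `K(T)`. -/
def ratDerivation (δ : RingDerivation K) (s : K) : RingDerivation (RatFunc K) :=
  localizationDerivation _ (nonZeroDivisors (Polynomial K)) (polyDerivation δ s)

theorem ratDerivation_algebraMap (δ : RingDerivation K) (s : K) (p : Polynomial K) :
    ratDerivation δ s (algebraMap _ (RatFunc K) p) =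
      algebraMap _ (RatFunc K) (polyDerivation δ s p) :=
  localizationDerivation_algebraMap _ _ p

theorem coe_ratDerivation (δ : RingDerivation K) (s : K) : ⇑(ratDerivation δ s) = ratDeriv δ s := by
  ext1 x
  conv_lhs => rw [← RatFunc.num_div_denom x, RingDerivation.apply_div]
  simp only [ratDeriv, ratDerivation_algebraMap, polyDerivation_apply]

@[simp]
theorem ratDerivation_C (δ : RingDerivation K) (s a : K) :
    ratDerivation δ s (RatFunc.C a) = RatFunc.C (δ a) := by
  rw [← RatFunc.algebraMap_C, ratDerivation_algebraMap, ← RatFunc.algebraMap_C,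
    polyDerivation_apply]
  simp [polyDeriv]

@[simp]
theorem ratDerivation_X (δ : RingDerivation K) (s : K) :
    ratDerivation δ s RatFunc.X = RatFunc.C s := by
  rw [← RatFunc.algebraMap_X, ratDerivation_algebraMap, ← RatFunc.algebraMap_C,
    polyDerivation_apply]
  simp [polyDeriv, Polynomial.sum_X_index]

end AdjoinDerivation

section Laurent

open PowerSeries

theorem coeff_ddt (f : LaurentSeries ℂ) (n : ℤ) :
    (ddt f).coeff n = (n + 1) * f.coeff (n + 1) := by
  simp [ddt, LaurentSeries.derivative_apply, LaurentSeries.hasseDeriv_coeff]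

theorem ddt_toLaurent (g : PowerSeries ℂ) : ddt (toLaurent g) = toLaurent (d⁄dX ℂ g) := by
  ext n
  rw [coeff_ddt]
  change _ * (g : LaurentSeries ℂ).coeff _ = ((d⁄dX ℂ g : PowerSeries ℂ) : LaurentSeries ℂ).coeff _
  rw [PowerSeries.coeff_coe, PowerSeries.coeff_coe]
  rcases lt_trichotomy n (-1) with h | rfl | h
  · rw [if_pos (by omega), if_pos (by omega), mul_zero]
  · simp
  · obtain ⟨k, rfl⟩ : ∃ k : ℕ, n = k := ⟨n.toNat, by omega⟩
    rw [if_neg (by omega), if_neg (by omega), PowerSeries.coeff_derivative,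
      show ((k : ℤ) + 1).natAbs = k + 1 by omega]
    simp
    ring

theorem ddt_single_mul (m : ℤ) (f : LaurentSeries ℂ) :
    ddt (HahnSeries.single m 1 * f) =
      HahnSeries.single m 1 * ddt f + HahnSeries.single (m - 1) (m : ℂ) * f := by
  ext n
  rw [HahnSeries.coeff_add, coeff_ddt, HahnSeries.coeff_single_mul, HahnSeries.coeff_single_mul,
    HahnSeries.coeff_single_mul, coeff_ddt, show n - m + 1 = n + 1 - m by ring,
    show n - (m - 1) = n + 1 - m by ring]
  push_cast
  ring

/-- `d/dt` as a derivation of `ℂ((t))`. -/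
def laurentDerivation : RingDerivation (LaurentSeries ℂ) :=
  localizationDerivation _ (Submonoid.powers (X : PowerSeries ℂ)) (.ofLinear (d⁄dX ℂ))

theorem laurentDerivation_toLaurent (g : PowerSeries ℂ) :
    laurentDerivation (toLaurent g) = toLaurent (d⁄dX ℂ g) :=
  localizationDerivation_algebraMap _ _ g

theorem laurentDerivation_single_one (m : ℤ) :
    laurentDerivation (HahnSeries.single m 1) = HahnSeries.single (m - 1) (m : ℂ) := by
  have hX : laurentDerivation (HahnSeries.single 1 1) = 1 := by
    rw [← PowerSeries.coe_X]
    exact (laurentDerivation_toLaurent X).trans (by rw [derivative_X, map_one])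
  rw [RatFunc.single_zpow, RingDerivation.apply_zpow, hX, ← RatFunc.single_zpow, mul_one,
    ← map_intCast (HahnSeries.C : ℂ →+* LaurentSeries ℂ), HahnSeries.C_apply,
    HahnSeries.single_mul_single, zero_add, mul_one]

theorem coe_laurentDerivation : ⇑laurentDerivation = ddt := by
  ext1 f
  rw [← f.single_order_mul_powerSeriesPart, ddt_single_mul, RingDerivation.apply_mul,
    laurentDerivation_single_one]
  change _ * laurentDerivation (toLaurent _) + _ = _ * ddt (toLaurent _) + _
  rw [laurentDerivation_toLaurent, ddt_toLaurent, mul_comm (HahnSeries.ofPowerSeries ℤ ℂ _)]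

theorem ddt_C (c : ℂ) : ddt (HahnSeries.C c) = 0 := by
  rw [← PowerSeries.coe_C]
  exact (ddt_toLaurent _).trans (by rw [derivative_C, map_zero])

theorem eq_C_of_ddt_eq_zero {f : LaurentSeries ℂ} (h : ddt f = 0) :
    f = HahnSeries.C (f.coeff 0) := by
  ext n
  rcases eq_or_ne n 0 with rfl | hn
  · rw [HahnSeries.C_apply, HahnSeries.coeff_single_same]
  · rw [HahnSeries.C_apply, HahnSeries.coeff_single_of_ne hn]
    have hcoeff := coeff_ddt f (n - 1)
    rw [h, HahnSeries.coeff_zero, Int.cast_sub, Int.cast_one, sub_add_cancel, sub_add_cancel]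
      at hcoeff
    exact (mul_eq_zero.mp hcoeff.symm).resolve_left (Int.cast_ne_zero.mpr hn)

theorem ratToLaurent_algebraMap (p : Polynomial ℂ) :
    ratToLaurent (algebraMap (Polynomial ℂ) (RatFunc ℂ) p) = toLaurent (p : PowerSeries ℂ) :=
  (RatFunc.coe_coe p).symm

theorem ratToLaurent_C (c : ℂ) : ratToLaurent (RatFunc.C c) = HahnSeries.C c := by
  rw [← RatFunc.algebraMap_C, ratToLaurent_algebraMap, Polynomial.coe_C]
  exact PowerSeries.coe_C c

theorem ratToLaurent_X : ratToLaurent RatFunc.X = toLaurent X := by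
  rw [← RatFunc.algebraMap_X, ratToLaurent_algebraMap, Polynomial.coe_X]

/-- The derivation `d/dt` of `K(t)`. -/
def ratDer {K : Type*} [Field K] : RingDerivation (RatFunc K) := ratDerivation 0 1

theorem ddt_ratToLaurent (q : RatFunc ℂ) : ddt (ratToLaurent q) = ratToLaurent (ratDer q) := by
  have h := derivation_map_ratFunc_eq (D := ratDer) (D' := laurentDerivation) (φ := ratToLaurent)
    (r := 1) (fun a => ?_) ?_ q
  · rwa [one_mul, coe_laurentDerivation] at h
  · rw [coe_laurentDerivation, ratToLaurent_C, ddt_C, ratDer, ratDerivation_C]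
    simp
  · rw [coe_laurentDerivation, ratToLaurent_X, ddt_toLaurent, derivative_X, ratDer, ratDerivation_X]
    simp

variable {R : PowerSeries ℂ} {h0 : constantCoeff R = 0} {hne : R ≠ 0}

theorem Phi_toLaurent (g : PowerSeries ℂ) : Phi R h0 hne (toLaurent g) = toLaurent (g.subst R) := by
  rw [← compPower_apply R h0]
  exact IsLocalization.Away.lift_eq X (isUnit_compPower_X R h0 hne) g

theorem Phi_C (c : ℂ) : Phi R h0 hne (HahnSeries.C c) = HahnSeries.C c := by
  have h := Phi_toLaurent (h0 := h0) (hne := hne) (C c)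
  rw [subst_C] at h
  rwa [← PowerSeries.coe_C]

theorem ddt_Phi (f : LaurentSeries ℂ) :
    ddt (Phi R h0 hne f) = ddt (toLaurent R) * Phi R h0 hne (ddt f) := by
  rw [← coe_laurentDerivation]
  refine derivation_map_eq_of_isFractionRing (A := PowerSeries ℂ) (fun g => ?_) f
  change laurentDerivation (Phi R h0 hne (toLaurent g)) =
    laurentDerivation (toLaurent R) * Phi R h0 hne (laurentDerivation (toLaurent g))
  simp only [Phi_toLaurent, laurentDerivation_toLaurent]
  rw [derivative_subst (HasSubst.of_constantCoeff_zero' h0), mul_comm, map_mul]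

theorem Phi_ratToLaurent_mem_fieldRange (hrat : IsRational (toLaurent R)) (q : RatFunc ℂ) :
    Phi R h0 hne (ratToLaurent q) ∈ ratToLaurent.fieldRange := by
  refine mem_subfield_ratFunc
    (S := ratToLaurent.fieldRange.comap ((Phi R h0 hne).comp ratToLaurent))
    (fun a => ⟨RatFunc.C a, ?_⟩) ?_ q
  · rw [RingHom.comp_apply, ratToLaurent_C, Phi_C]
  · rwa [Subfield.mem_comap, RingHom.comp_apply, ratToLaurent_X, Phi_toLaurent,
      subst_X (HasSubst.of_constantCoeff_zero' h0)]

end Laurent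

section FixedElements

open PowerSeries

section Substitution

variable {A : Type*} [CommRing A] {R S U V h : PowerSeries A}

theorem exists_eq_X_mul (h0 : constantCoeff R = 0) :
    ∃ U, R = X * U ∧ constantCoeff U = coeff 1 R := by
  obtain ⟨U, rfl⟩ := X_dvd_iff.mpr h0
  exact ⟨U, rfl, by rw [← coeff_zero_eq_constantCoeff_apply, ← coeff_succ_X_mul 0 U]⟩

theorem coeff_X_pow_mul_self (m : ℕ) (p : PowerSeries A) :
    coeff m (X ^ m * p) = constantCoeff p := by
  simpa using coeff_X_pow_mul p m 0

theorem coeff_subst_of_forall_lt (h0 : constantCoeff R = 0) {m : ℕ} (hlt : ∀ i < m, coeff i h = 0) :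
    coeff m (h.subst R) = coeff m h * coeff 1 R ^ m := by
  obtain ⟨U, rfl, hU⟩ := exists_eq_X_mul h0
  rw [coeff_subst' (HasSubst.of_constantCoeff_zero' h0), finsum_eq_single _ m, smul_eq_mul,
    mul_pow, coeff_X_pow_mul_self, map_pow, hU]
  intro d hd
  rcases hd.lt_or_gt with hlt' | hgt
  · rw [hlt d hlt', zero_smul]
  · rw [mul_pow, coeff_X_pow_mul', if_neg hgt.not_ge, smul_zero]

theorem coeff_subst_sub (hS : HasSubst S) (h : PowerSeries A) (n : ℕ) :
    coeff n (h.subst S - h) = ∑ᶠ d, coeff d h • coeff n (S ^ d - X ^ d) := by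
  have hX : coeff n h = ∑ᶠ d, coeff d h • coeff n (X ^ d) := by
    rw [← coeff_subst' HasSubst.X', X_subst]
  rw [map_sub, coeff_subst' hS, hX, ← finsum_sub_distrib (coeff_subst_finite' hS h n)
    (coeff_subst_finite' HasSubst.X' h n)]
  simp only [map_sub, smul_sub]

-- `(X U) ^ d - X ^ d = X ^ d (U - 1) (1 + U + ⋯ + U ^ (d - 1))`, so only `d = m` contributes.
theorem coeff_subst_X_mul_sub {j m : ℕ} (hU : U - 1 = X ^ j * V) (hU1 : constantCoeff U = 1)
    (hlt : ∀ i < m, coeff i h = 0) :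
    coeff (m + j) (h.subst (X * U) - h) = coeff m h * (m * constantCoeff V) := by
  have hpow (d : ℕ) :
      (X * U) ^ d - X ^ d = X ^ (d + j) * ((∑ i ∈ Finset.range d, U ^ i) * V) := by
    rw [mul_pow, ← mul_sub_one, ← geom_sum_mul, hU]
    ring
  rw [coeff_subst_sub (HasSubst.of_constantCoeff_zero' (by simp)), finsum_eq_single _ m, hpow,
    coeff_X_pow_mul_self]
  · simp [hU1]
  · intro d hd
    rcases hd.lt_or_gt with hlt' | hgt
    · rw [hlt d hlt', zero_smul]
    · rw [hpow, coeff_X_pow_mul', if_neg (by omega), smul_zero]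

theorem eq_X_of_subst_eq_self [IsDomain A] [CharZero A] (h0 : constantCoeff S = 0)
    (h1 : coeff 1 S = 1) {m : ℕ} (hm0 : m ≠ 0) (hm : coeff m h ≠ 0) (hlt : ∀ i < m, coeff i h = 0)
    (hh : h.subst S = h) : S = X := by
  obtain ⟨U, rfl, hU⟩ := exists_eq_X_mul h0
  by_contra hS
  have hU1 : U - 1 ≠ 0 := fun hU1 => hS (by rw [sub_eq_zero.mp hU1, mul_one])
  obtain ⟨V, hV⟩ : X ^ (U - 1).order.toNat ∣ U - 1 := X_pow_order_dvd
  have hV0 : constantCoeff V ≠ 0 := by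
    rw [← coeff_X_pow_mul_self (U - 1).order.toNat V, ← hV]
    exact coeff_order hU1
  have hcoeff := coeff_subst_X_mul_sub hV (hU.trans h1) hlt
  rw [hh, sub_self, map_zero] at hcoeff
  exact mul_ne_zero hm (mul_ne_zero (Nat.cast_ne_zero.mpr hm0) hV0) hcoeff.symm

end Substitution

variable {R : PowerSeries ℂ}

theorem iter_succ (R : PowerSeries ℂ) (n : ℕ) : iter R (n + 1) = (iter R n).subst R :=
  Function.iterate_succ_apply' _ _ _

theorem constantCoeff_iter (h0 : constantCoeff R = 0) (n : ℕ) : constantCoeff (iter R n) = 0 := by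
  induction n with
  | zero => exact constantCoeff_X
  | succ n ih => exact (congrArg _ (iter_succ R n)).trans (constantCoeff_subst_eq_zero h0 _ ih)

theorem coeff_one_iter (h0 : constantCoeff R = 0) (n : ℕ) :
    coeff 1 (iter R n) = coeff 1 R ^ n := by
  induction n with
  | zero => exact coeff_one_X
  | succ n ih =>
    have hlt : ∀ i < 1, coeff i (iter R n) = 0 := fun i hi => by
      rw [Nat.lt_one_iff.mp hi, coeff_zero_eq_constantCoeff_apply, constantCoeff_iter h0]
    rw [iter_succ, coeff_subst_of_forall_lt h0 hlt, ih, pow_one, pow_succ]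

theorem subst_iter {h : PowerSeries ℂ} (h0 : constantCoeff R = 0) (hh : h.subst R = h) (n : ℕ) :
    h.subst (iter R n) = h := by
  induction n with
  | zero => exact X_subst h
  | succ n ih =>
    rw [iter_succ, ← subst_comp_subst_apply
      (HasSubst.of_constantCoeff_zero' (constantCoeff_iter h0 n))
      (HasSubst.of_constantCoeff_zero' h0), ih, hh]

theorem order_inv {K : Type*} [Field K] (x : LaurentSeries K) : x⁻¹.order = -x.order := by
  rcases eq_or_ne x 0 with rfl | hx
  · simp
  · have h := HahnSeries.order_mul hx (inv_ne_zero hx)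
    rw [mul_inv_cancel₀ hx, HahnSeries.order_one] at h
    omega

theorem exists_toLaurent_eq {x : LaurentSeries ℂ} (hx : x ≠ 0) {m : ℕ} (hm : x.order = m) :
    ∃ h : PowerSeries ℂ, toLaurent h = x ∧ coeff m h ≠ 0 ∧ ∀ i < m, coeff i h = 0 := by
  refine ⟨X ^ m * x.powerSeriesPart, LaurentSeries.X_order_mul_powerSeriesPart hm.symm, ?_,
    fun i hi => ?_⟩
  · rw [coeff_X_pow_mul_self, ← coeff_zero_eq_constantCoeff_apply,
      LaurentSeries.powerSeriesPart_coeff]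
    simpa using HahnSeries.coeff_order_eq_zero.not.mpr hx
  · rw [coeff_X_pow_mul', if_neg hi.not_ge]

variable {h0 : constantCoeff R = 0} {hne : R ≠ 0}

theorem eq_coeff_one_pow_of_Phi_eq {x : LaurentSeries ℂ} {c : ℂ} {m : ℕ} (hx0 : x ≠ 0)
    (hm : x.order = m) (hx : Phi R h0 hne x = HahnSeries.C c * x) : c = coeff 1 R ^ m := by
  obtain ⟨h, rfl, hh, hlt⟩ := exists_toLaurent_eq hx0 hm
  have hsubst : h.subst R = C c * h := by
    apply HahnSeries.ofPowerSeries_injective (Γ := ℤ)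
    rw [← Phi_toLaurent (h0 := h0) (hne := hne), hx, map_mul]
    exact congrArg (· * toLaurent h) (PowerSeries.coe_C c).symm
  have hcoeff := congrArg (coeff m) hsubst
  rw [coeff_subst_of_forall_lt h0 hlt, coeff_C_mul, mul_comm] at hcoeff
  exact (mul_right_cancel₀ hh hcoeff).symm

theorem eq_coeff_one_zpow_order_of_Phi_eq {x : LaurentSeries ℂ} {c : ℂ} (hx0 : x ≠ 0)
    (hx : Phi R h0 hne x = HahnSeries.C c * x) : c = coeff 1 R ^ x.order := by
  obtain ⟨m, hm | hm⟩ := x.order.eq_nat_or_neg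
  · rw [hm, zpow_natCast, ← eq_coeff_one_pow_of_Phi_eq hx0 hm hx]
  · have hinv : Phi R h0 hne x⁻¹ = HahnSeries.C c⁻¹ * x⁻¹ := by
      rw [map_inv₀, hx, mul_inv, map_inv₀]
    rw [hm, zpow_neg, zpow_natCast, ← inv_inj, inv_inv]
    exact eq_coeff_one_pow_of_Phi_eq (inv_ne_zero hx0) (by rw [order_inv, hm, neg_neg]) hinv

theorem eq_one_of_Phi_eq_C_mul (h1 : coeff 1 R = 0) {x : LaurentSeries ℂ} {c : ℂ} (hx0 : x ≠ 0)
    (hx : Phi R h0 hne x = HahnSeries.C c * x) : c = 1 := by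
  have hc : c ≠ 0 := by
    rintro rfl
    rw [map_zero, zero_mul] at hx
    exact (map_ne_zero _).mpr hx0 hx
  have hpow := eq_coeff_one_zpow_order_of_Phi_eq hx0 hx
  rw [h1] at hpow
  rcases eq_or_ne x.order 0 with hord | hord
  · rwa [hord, zpow_zero] at hpow
  · exact absurd (hpow.trans (zero_zpow _ hord)) hc

/-- A fixed element of positive order `m` would make `R'(0)` an `m`-th root of unity, so that
`R^{∘m}`, which also fixes it, is tangent to the identity. -/
theorem not_order_pos_of_Phi_eq_self (hiter : ∀ n : ℕ, 1 ≤ n → iter R n ≠ X)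
    {x : LaurentSeries ℂ} (hx0 : x ≠ 0) (hx : Phi R h0 hne x = x) : ¬ 0 < x.order := by
  intro hpos
  lift x.order to ℕ using hpos.le with m hm
  have hm0 : m ≠ 0 := by omega
  have hroot : (1 : ℂ) = coeff 1 R ^ m :=
    eq_coeff_one_pow_of_Phi_eq hx0 hm.symm (by rw [hx, map_one, one_mul])
  obtain ⟨h, rfl, hh, hlt⟩ := exists_toLaurent_eq hx0 hm.symm
  have hfix : h.subst R = h := by
    apply HahnSeries.ofPowerSeries_injective (Γ := ℤ)
    rwa [← Phi_toLaurent (h0 := h0) (hne := hne)]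
  exact hiter m (Nat.one_le_iff_ne_zero.mpr hm0) (eq_X_of_subst_eq_self (constantCoeff_iter h0 m)
    ((coeff_one_iter h0 m).trans hroot.symm) hm0 hh hlt (subst_iter h0 hfix m))

theorem eq_C_of_Phi_eq_self (hiter : ∀ n : ℕ, 1 ≤ n → iter R n ≠ X) {x : LaurentSeries ℂ}
    (hx : Phi R h0 hne x = x) : x = HahnSeries.C (x.coeff 0) := by
  by_contra hxC
  set z := x - HahnSeries.C (x.coeff 0) with hz
  have hz0 : z ≠ 0 := sub_ne_zero.mpr hxC
  have hΦz : Phi R h0 hne z = z := by rw [hz, map_sub, hx, Phi_C]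
  have hpos : ¬ 0 < z.order := not_order_pos_of_Phi_eq_self hiter hz0 hΦz
  have hneg : ¬ 0 < z⁻¹.order :=
    not_order_pos_of_Phi_eq_self hiter (inv_ne_zero hz0) (by rw [map_inv₀, hΦz])
  have hord : z.order = 0 := by
    rw [order_inv] at hneg
    omega
  refine hz0 (HahnSeries.coeff_order_eq_zero.mp ?_)
  rw [hord, hz, HahnSeries.coeff_sub, HahnSeries.C_apply, HahnSeries.coeff_single_same, sub_self]

end FixedElements

section AffineEndomorphisms

open Polynomial

variable {K : Type*} [Field K] (φ : K →+* K) {α : K} (hα : α ≠ 0) (β : K)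

theorem ratEndo_algebraMap (p : K[X]) :
    ratEndo φ α hα β (algebraMap K[X] (RatFunc K) p) =
      algebraMap K[X] (RatFunc K) (polyEndo φ α β p) := by
  have h := RatFunc.map_apply_div (polyEndo φ α β)
    (nonZeroDivisors_le_comap_nonZeroDivisors_of_injective _ (polyEndo_injective φ hα β)) p 1
  simp only [map_one, div_one] at h
  exact h

theorem ratEndo_C (a : K) : ratEndo φ α hα β (RatFunc.C a) = RatFunc.C (φ a) := by
  rw [← RatFunc.algebraMap_C, ratEndo_algebraMap, ← RatFunc.algebraMap_C]
  simp [polyEndo]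

theorem ratEndo_X :
    ratEndo φ α hα β RatFunc.X = RatFunc.C α * RatFunc.X + RatFunc.C β := by
  rw [← RatFunc.algebraMap_X, ratEndo_algebraMap]
  simp [polyEndo]

theorem polyEndo_eq_comp (p : K[X]) :
    polyEndo φ α β p = (p.map φ).comp (C α * X + C β) := by
  simp [polyEndo, comp, eval₂_map]

include hα in
theorem natDegree_polyEndo (p : K[X]) : (polyEndo φ α β p).natDegree = p.natDegree := by
  rw [polyEndo_eq_comp, natDegree_comp, natDegree_linear hα, mul_one, natDegree_map]

include hα in
theorem leadingCoeff_polyEndo (p : K[X]) :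
    (polyEndo φ α β p).leadingCoeff = φ p.leadingCoeff * α ^ p.natDegree := by
  rw [polyEndo_eq_comp, leadingCoeff_comp (by rw [natDegree_linear hα]; exact one_ne_zero),
    leadingCoeff_linear hα, natDegree_map, leadingCoeff_map]

variable {φ hα β} {x : RatFunc K} (hx : ratEndo φ α hα β x = x)
include hx

theorem polyEndo_num_mul_denom_of_ratEndo_eq_self :
    polyEndo φ α β x.num * x.denom = x.num * polyEndo φ α β x.denom := by
  have hdenom : polyEndo φ α β x.denom ≠ 0 :=
    (map_ne_zero_iff _ (polyEndo_injective φ hα β)).mpr x.denom_ne_zero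
  apply RatFunc.algebraMap_injective K
  rw [map_mul, map_mul, ← div_eq_div_iff (RatFunc.algebraMap_ne_zero hdenom)
    (RatFunc.algebraMap_ne_zero x.denom_ne_zero), RatFunc.num_div_denom,
    ← ratEndo_algebraMap φ hα, ← ratEndo_algebraMap φ hα, ← map_div₀, RatFunc.num_div_denom, hx]

theorem polyEndo_denom_of_ratEndo_eq_self :
    polyEndo φ α β x.denom = C (α ^ x.denom.natDegree) * x.denom := by
  have hdvd : x.denom ∣ polyEndo φ α β x.denom :=
    (RatFunc.isCoprime_num_denom x).symm.dvd_of_dvd_mul_left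
      (polyEndo_num_mul_denom_of_ratEndo_eq_self hx ▸ dvd_mul_left _ _)
  rw [eq_leadingCoeff_mul_of_monic_of_dvd_of_natDegree_le x.monic_denom hdvd
    (natDegree_polyEndo φ hα β _).le, leadingCoeff_polyEndo φ hα, x.monic_denom.leadingCoeff,
    map_one, one_mul]

theorem polyEndo_num_of_ratEndo_eq_self :
    polyEndo φ α β x.num = C (α ^ x.denom.natDegree) * x.num := by
  apply mul_right_cancel₀ x.denom_ne_zero
  rw [polyEndo_num_mul_denom_of_ratEndo_eq_self hx, polyEndo_denom_of_ratEndo_eq_self hx]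
  ring

-- The numerator and the denominator of `x` are eigenvectors for the same power of `α`. If `a` is
-- the leading coefficient of `x.num`, so is `x.num - C a * x.denom`, but its degree is too small.
theorem exists_eq_C_of_ratEndo_eq_self
    (hφ : ∀ a ≠ 0, ∀ m n : ℕ, φ a * α ^ m = α ^ n * a → m = n) :
    ∃ a, φ a = a ∧ x = RatFunc.C a := by
  have hdeg (p : K[X]) (hp : p ≠ 0) (h : polyEndo φ α β p = C (α ^ x.denom.natDegree) * p) :
      p.natDegree = x.denom.natDegree ∧ φ p.leadingCoeff = p.leadingCoeff := by
    have hlc := congrArg leadingCoeff h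
    rw [leadingCoeff_polyEndo φ hα, leadingCoeff_mul, leadingCoeff_C] at hlc
    have hnat := hφ _ (leadingCoeff_ne_zero.mpr hp) _ _ hlc
    rw [hnat, mul_comm] at hlc
    exact ⟨hnat, mul_left_cancel₀ (pow_ne_zero _ hα) hlc⟩
  rcases eq_or_ne x 0 with rfl | hx0
  · exact ⟨0, map_zero φ, (map_zero _).symm⟩
  have hnum := polyEndo_num_of_ratEndo_eq_self hx
  obtain ⟨hnat, hfix⟩ := hdeg x.num (RatFunc.num_ne_zero hx0) hnum
  set a := x.num.leadingCoeff
  have hsub : x.num - C a * x.denom = 0 := by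
    by_contra hne
    have hCa : polyEndo φ α β (C a) = C a := by simp [polyEndo, hfix]
    obtain ⟨hnat', -⟩ := hdeg _ hne (by
      rw [map_sub, map_mul, hCa, hnum, polyEndo_denom_of_ratEndo_eq_self hx]
      ring)
    apply leadingCoeff_ne_zero.mpr hne
    rw [leadingCoeff, hnat', coeff_sub, coeff_C_mul, x.monic_denom.coeff_natDegree, mul_one,
      ← hnat, coeff_natDegree, sub_self]
  refine ⟨a, hfix, ?_⟩
  rw [← RatFunc.num_div_denom x, sub_eq_zero.mp hsub, map_mul, RatFunc.algebraMap_C,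
    mul_div_cancel_right₀ _ (RatFunc.algebraMap_ne_zero x.denom_ne_zero)]

end AffineEndomorphisms

section LogField

open PowerSeries

/-- `d/dt` as a derivation of `ℂ((t))(log t)`. -/
def ddtLogDerivation : RingDerivation LogField :=
  ratDerivation laurentDerivation (HahnSeries.single (-1) 1)

theorem coe_ddtLogDerivation : ⇑ddtLogDerivation = ddtLog := by
  rw [ddtLogDerivation, coe_ratDerivation, coe_laurentDerivation, ddtLog]

theorem ddtLogDerivation_toLog (f : LaurentSeries ℂ) :
    ddtLogDerivation (toLog f) = toLog (ddt f) := by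
  rw [← coe_laurentDerivation]
  exact ratDerivation_C _ _ f

theorem ddtLogDerivation_X :
    ddtLogDerivation RatFunc.X = toLog (HahnSeries.single (-1) 1) :=
  ratDerivation_X _ _

theorem mul_derivative_logOf {W : PowerSeries ℂ} (hW : constantCoeff W = 1) :
    W * d⁄dX ℂ (logOf W) = d⁄dX ℂ W := by
  have hs : HasSubst (W - 1) := HasSubst.of_constantCoeff_zero' (by simp [hW])
  have hlog : (1 + X) * d⁄dX ℂ (PowerSeries.log ℂ) = 1 := by
    rw [deriv_log]
    ext n
    cases n with
    | zero => simp [add_mul]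
    | succ n => simp [add_mul, coeff_succ_X_mul, coeff_one, pow_succ]
  have h := congrArg (substAlgHom (R := ℂ) hs) hlog
  rw [map_mul, map_add, map_one, substAlgHom_X, add_sub_cancel, coe_substAlgHom] at h
  rw [logOf_eq, derivative_subst hs, ← mul_assoc, h, one_mul, map_sub, ← map_one (C (R := ℂ)),
    derivative_C, sub_zero]

variable {R : PowerSeries ℂ}

theorem toLaurent_ne_zero {g : PowerSeries ℂ} (hg : g ≠ 0) : toLaurent g ≠ 0 :=
  (map_ne_zero_iff _ HahnSeries.ofPowerSeries_injective).mpr hg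

theorem single_neg_one_eq_inv : HahnSeries.single (-1) 1 = (toLaurent X)⁻¹ := by
  rw [HahnSeries.ofPowerSeries_X, HahnSeries.inv_single, inv_one]

theorem constantCoeff_leadCoeff_inv_mul_divXPowOrder (hne : R ≠ 0) :
    constantCoeff (C (leadCoeff R)⁻¹ * R.divXPowOrder) = 1 := by
  rw [map_mul, constantCoeff_C, constantCoeff_divXPowOrder]
  exact inv_mul_cancel₀ (coeff_order hne)

theorem toLaurent_eq_leadCoeff_mul (hne : R ≠ 0) :
    toLaurent R = HahnSeries.C (leadCoeff R) *
      (toLaurent X ^ ord R * toLaurent (C (leadCoeff R)⁻¹ * R.divXPowOrder)) := by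
  have hr : leadCoeff R ≠ 0 := coeff_order hne
  have hC : toLaurent (C (leadCoeff R)) = HahnSeries.C (leadCoeff R) := PowerSeries.coe_C _
  have hRW : R = C (leadCoeff R) * (X ^ ord R * (C (leadCoeff R)⁻¹ * R.divXPowOrder)) := by
    rw [mul_left_comm (X ^ ord R), ord, X_pow_order_mul_divXPowOrder, ← mul_assoc, ← map_mul,
      mul_inv_cancel₀ hr, map_one, one_mul]
  conv_lhs => rw [hRW, map_mul, map_mul, map_pow, hC]

theorem ddt_logRest (hne : R ≠ 0) (l : ℂ) :
    ddt (logRest R l) =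
      laurentDerivation.logDeriv (toLaurent (C (leadCoeff R)⁻¹ * R.divXPowOrder)) := by
  have hW := constantCoeff_leadCoeff_inv_mul_divXPowOrder hne
  rw [logRest]
  generalize C (leadCoeff R)⁻¹ * R.divXPowOrder = W at hW ⊢
  have hW0 : W ≠ 0 := by
    rintro rfl
    simp at hW
  rw [RingDerivation.logDeriv, laurentDerivation_toLaurent, eq_div_iff (toLaurent_ne_zero hW0),
    ← mul_derivative_logOf hW, map_mul, mul_comm, ← coe_laurentDerivation, map_add,
    laurentDerivation_toLaurent, coe_laurentDerivation, ddt_C, zero_add]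

theorem logDeriv_toLaurent (hne : R ≠ 0) (l : ℂ) :
    laurentDerivation.logDeriv (toLaurent R) =
      HahnSeries.C (ord R : ℂ) * HahnSeries.single (-1) 1 + ddt (logRest R l) := by
  have hC : laurentDerivation (HahnSeries.C (leadCoeff R)) = 0 := by
    rw [coe_laurentDerivation, ddt_C]
  have hX : laurentDerivation.logDeriv (toLaurent X) = HahnSeries.single (-1) 1 := by
    rw [RingDerivation.logDeriv, laurentDerivation_toLaurent, derivative_X, map_one, one_div,
      single_neg_one_eq_inv]
  have hR0 := toLaurent_ne_zero hne
  have hRW := toLaurent_eq_leadCoeff_mul hne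
  rw [hRW] at hR0
  obtain ⟨hr0, hXW⟩ := mul_ne_zero_iff.mp hR0
  obtain ⟨hX0, hW0⟩ := mul_ne_zero_iff.mp hXW
  conv_lhs => rw [hRW]
  rw [RingDerivation.logDeriv_mul _ hr0 hXW, RingDerivation.logDeriv_mul _ hX0 hW0,
    ← zpow_natCast, RingDerivation.logDeriv_zpow _ (toLaurent_ne_zero X_ne_zero), hX,
    ← ddt_logRest hne l, RingDerivation.logDeriv, hC, zero_div, zero_add, Int.cast_natCast,
    map_natCast]

variable {h0 : constantCoeff R = 0} {hne : R ≠ 0} {l : ℂ}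

theorem PhiLog_toLog (f : LaurentSeries ℂ) :
    PhiLog R h0 hne l (toLog f) = toLog (Phi R h0 hne f) :=
  ratEndo_C _ _ _ f

theorem PhiLog_X :
    PhiLog R h0 hne l RatFunc.X =
      toLog (HahnSeries.C (ord R : ℂ)) * RatFunc.X + toLog (logRest R l) :=
  ratEndo_X _ _ _

theorem logDeriv_toLaurent_eq_mul_Phi :
    laurentDerivation.logDeriv (toLaurent R) =
      ddt (toLaurent R) * Phi R h0 hne (HahnSeries.single (-1) 1) := by
  rw [single_neg_one_eq_inv, map_inv₀, Phi_toLaurent, subst_X (HasSubst.of_constantCoeff_zero' h0),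
    RingDerivation.logDeriv, coe_laurentDerivation, div_eq_mul_inv]

theorem ddtLogDerivation_PhiLog (x : LogField) :
    ddtLogDerivation (PhiLog R h0 hne l x) =
      toLog (ddt (toLaurent R)) * PhiLog R h0 hne l (ddtLogDerivation x) := by
  refine derivation_map_ratFunc_eq (fun f => ?_) ?_ x
  · change ddtLogDerivation (PhiLog R h0 hne l (toLog f)) =
      _ * PhiLog R h0 hne l (ddtLogDerivation (toLog f))
    rw [PhiLog_toLog, ddtLogDerivation_toLog, ddtLogDerivation_toLog, PhiLog_toLog, ddt_Phi,
      map_mul]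
  · rw [PhiLog_X, ddtLogDerivation_X, PhiLog_toLog, ← map_mul, ← logDeriv_toLaurent_eq_mul_Phi,
      logDeriv_toLaurent hne l, map_add, RingDerivation.apply_mul, ddtLogDerivation_toLog,
      ddtLogDerivation_toLog, ddtLogDerivation_X, ddt_C, map_zero, mul_zero, add_zero, ← map_mul,
      ← map_add]

theorem two_le_ord (h0 : constantCoeff R = 0) (hne : R ≠ 0) (h1 : coeff 1 R = 0) : 2 ≤ ord R := by
  have hc : coeff (ord R) R ≠ 0 := coeff_order hne
  by_contra! h
  interval_cases ord R
  · exact hc (by rwa [coeff_zero_eq_constantCoeff_apply])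
  · exact hc h1

-- On a nonzero `a`, `Φ_R` has no eigenvalue but `1`, whereas `d ^ (n - m) ≠ 1` for `n ≠ m`.
theorem exists_eq_C_of_PhiLog_eq_self (h1 : coeff 1 R = 0)
    (hiter : ∀ n : ℕ, 1 ≤ n → iter R n ≠ X) {x : LogField} (hx : PhiLog R h0 hne l x = x) :
    ∃ c : ℂ, x = toLog (HahnSeries.C c) := by
  have hα := ord_cast_ne_zero R h0 hne
  have hord : (ord R : ℂ) ≠ 0 := fun h => hα (by rw [h, map_zero])
  obtain ⟨a, ha, rfl⟩ := exists_eq_C_of_ratEndo_eq_self hx fun a ha m n hmn => by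
    have hpow : (ord R : ℂ) ^ n / (ord R : ℂ) ^ m = 1 :=
      eq_one_of_Phi_eq_C_mul (h0 := h0) (hne := hne) h1 ha (by
        rw [map_div₀, map_pow, map_pow, div_mul_eq_mul_div, eq_div_iff (pow_ne_zero _ hα), hmn])
    rw [div_eq_one_iff_eq (pow_ne_zero _ hord)] at hpow
    exact (Nat.pow_right_injective (two_le_ord h0 hne h1) (by exact_mod_cast hpow)).symm
  exact ⟨a.coeff 0, congrArg RatFunc.C (eq_C_of_Phi_eq_self hiter ha)⟩

end LogField

section Residues

open PowerSeries

theorem coeff_zero_toLaurent (g : PowerSeries ℂ) : (toLaurent g).coeff 0 = constantCoeff g := by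
  simpa using HahnSeries.ofPowerSeries_apply_coeff (Γ := ℤ) g 0

theorem coeff_toLaurent_of_neg (g : PowerSeries ℂ) {n : ℤ} (hn : n < 0) :
    (toLaurent g).coeff n = 0 :=
  (PowerSeries.coeff_coe g n).trans (if_pos hn)

theorem order_toLaurent_eq_zero_iff {g : PowerSeries ℂ} (hg : g ≠ 0) :
    (toLaurent g).order = 0 ↔ constantCoeff g ≠ 0 := by
  have hcoeff := HahnSeries.coeff_order_eq_zero.not.mpr (toLaurent_ne_zero hg)
  rw [← coeff_zero_toLaurent]
  refine ⟨fun h => h ▸ hcoeff, fun h => le_antisymm (HahnSeries.order_le_of_coeff_ne_zero h) ?_⟩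
  contrapose! hcoeff
  exact coeff_toLaurent_of_neg g hcoeff

theorem coeff_neg_one_ddt (x : LaurentSeries ℂ) : (ddt x).coeff (-1) = 0 := by
  rw [coeff_ddt, Int.cast_neg, Int.cast_one, neg_add_cancel, zero_mul]

theorem coeff_neg_one_logDeriv {x : LaurentSeries ℂ} (hx : x ≠ 0) :
    (laurentDerivation.logDeriv x).coeff (-1) = x.order := by
  have hsingle : laurentDerivation.logDeriv (HahnSeries.single x.order 1) =
      HahnSeries.single (-1) (x.order : ℂ) := by
    rw [RingDerivation.logDeriv, laurentDerivation_single_one, div_eq_mul_inv,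
      HahnSeries.inv_single, HahnSeries.single_mul_single, inv_one, mul_one,
      show x.order - 1 + -x.order = -1 by ring]
  obtain ⟨u, hu, hxu⟩ : ∃ u : PowerSeries ℂ, constantCoeff u ≠ 0 ∧
      HahnSeries.single x.order 1 * toLaurent u = x := by
    refine ⟨x.powerSeriesPart, ?_, x.single_order_mul_powerSeriesPart⟩
    rw [← coeff_zero_eq_constantCoeff_apply, LaurentSeries.powerSeriesPart_coeff]
    simpa using hx
  have hunit : laurentDerivation.logDeriv (toLaurent u) = toLaurent (d⁄dX ℂ u * u⁻¹) := by
    have hu0 : u ≠ 0 := by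
      rintro rfl
      exact hu (map_zero _)
    rw [RingDerivation.logDeriv, laurentDerivation_toLaurent,
      div_eq_iff (toLaurent_ne_zero hu0), ← map_mul, mul_assoc, PowerSeries.inv_mul_cancel _ hu,
      mul_one]
  have hx' := hxu ▸ hx
  conv_lhs => rw [← hxu, RingDerivation.logDeriv_mul _ (left_ne_zero_of_mul hx')
    (right_ne_zero_of_mul hx'), hsingle, hunit]
  rw [HahnSeries.coeff_add, coeff_toLaurent_of_neg _ neg_one_lt_zero, add_zero,
    HahnSeries.coeff_single_same]

theorem order_zpow {K : Type*} [Field K] (x : LaurentSeries K) (n : ℤ) :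
    (x ^ n).order = n * x.order := by
  cases n with
  | ofNat n => simp
  | negSucc n =>
    rw [zpow_negSucc, order_inv, HahnSeries.order_pow, Int.negSucc_eq]
    ring

/-- The expansion of a rational function at `p`, as a Laurent series in `t - p`. -/
def expandAt (p : ℂ) : RatFunc ℂ →+* LaurentSeries ℂ :=
  ratToLaurent.comp (ratEndo (RingHom.id ℂ) 1 one_ne_zero p)

theorem expandAt_algebraMap (p : ℂ) (P : Polynomial ℂ) :
    expandAt p (algebraMap (Polynomial ℂ) (RatFunc ℂ) P) =
      toLaurent (P.taylor p : PowerSeries ℂ) := by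
  rw [expandAt, RingHom.comp_apply, ratEndo_algebraMap, ratToLaurent_algebraMap, polyEndo_eq_comp,
    Polynomial.map_id, Polynomial.C_1, one_mul, Polynomial.taylor_apply]

theorem expandAt_C (p c : ℂ) : expandAt p (RatFunc.C c) = HahnSeries.C c := by
  rw [expandAt, RingHom.comp_apply, ratEndo_C, RingHom.id_apply, ratToLaurent_C]

theorem expandAt_X (p : ℂ) : expandAt p RatFunc.X = toLaurent X + HahnSeries.C p := by
  rw [expandAt, RingHom.comp_apply, ratEndo_X, map_one, one_mul, map_add, ratToLaurent_X,
    ratToLaurent_C]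

theorem expandAt_zero : expandAt 0 = ratToLaurent := by
  ext1 q
  obtain ⟨P, Q, -, rfl⟩ := IsFractionRing.div_surjective (A := Polynomial ℂ) q
  simp only [map_div₀, expandAt_algebraMap, ratToLaurent_algebraMap, Polynomial.taylor_zero]

theorem laurentDerivation_expandAt (p : ℂ) (q : RatFunc ℂ) :
    laurentDerivation (expandAt p q) = expandAt p (ratDer q) := by
  rw [derivation_map_ratFunc_eq (D := ratDer) (r := 1) (fun a => ?_) ?_ q, one_mul]
  · rw [expandAt_X, map_add, laurentDerivation_toLaurent, coe_laurentDerivation, ddt_C,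
      derivative_X, ratDer, ratDerivation_X]
    simp
  · rw [expandAt_C, coe_laurentDerivation, ddt_C, ratDer, ratDerivation_C]
    simp

/-- The order of a rational function at `p`, with the value `0` at the zero function. -/
def ordAt (p : ℂ) (w : RatFunc ℂ) : ℤ := (expandAt p w).order

theorem ordAt_mul (p : ℂ) {v w : RatFunc ℂ} (hv : v ≠ 0) (hw : w ≠ 0) :
    ordAt p (v * w) = ordAt p v + ordAt p w := by
  rw [ordAt, map_mul, HahnSeries.order_mul ((map_ne_zero _).mpr hv) ((map_ne_zero _).mpr hw),
    ordAt, ordAt]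

theorem ordAt_C (p c : ℂ) : ordAt p (RatFunc.C c) = 0 := by
  rw [ordAt, expandAt_C, HahnSeries.order_C]

theorem ordAt_prod_zpow {ι : Type*} (p : ℂ) (s : Finset ι) {w : ι → RatFunc ℂ}
    (hw : ∀ i ∈ s, w i ≠ 0) (n : ι → ℤ) :
    ordAt p (∏ i ∈ s, w i ^ n i) = ∑ i ∈ s, n i * ordAt p (w i) := by
  induction s using Finset.cons_induction with
  | empty => simpa using ordAt_C p 1
  | cons i s hi ih =>
    obtain ⟨hwi, hws⟩ := (Finset.forall_mem_cons hi _).mp hw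
    rw [Finset.prod_cons, Finset.sum_cons, ordAt_mul p (zpow_ne_zero _ hwi)
      (Finset.prod_ne_zero_iff.mpr fun j hj => zpow_ne_zero _ (hws j hj)), ih hws, ordAt, map_zpow₀,
      order_zpow, ordAt]

theorem ordAt_algebraMap_eq_zero_iff (p : ℂ) {P : Polynomial ℂ} (hP : P ≠ 0) :
    ordAt p (algebraMap (Polynomial ℂ) (RatFunc ℂ) P) = 0 ↔ P.eval p ≠ 0 := by
  rw [ordAt, expandAt_algebraMap, order_toLaurent_eq_zero_iff, Polynomial.constantCoeff_coe,
    Polynomial.taylor_coeff_zero]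
  rwa [Ne, Polynomial.coe_eq_zero_iff, Polynomial.taylor_eq_zero]

theorem algebraMap_X_sub_C {K : Type*} [Field K] (a : K) :
    algebraMap (Polynomial K) (RatFunc K) (Polynomial.X - Polynomial.C a) =
      RatFunc.X - RatFunc.C a := by
  rw [map_sub, RatFunc.algebraMap_X, RatFunc.algebraMap_C]

theorem X_sub_C_ne_zero {K : Type*} [Field K] (a : K) :
    (RatFunc.X - RatFunc.C a : RatFunc K) ≠ 0 := by
  rw [← algebraMap_X_sub_C]
  exact RatFunc.algebraMap_ne_zero (Polynomial.X_sub_C_ne_zero a)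

theorem ordAt_X_sub_C (p a : ℂ) :
    ordAt p (RatFunc.X - RatFunc.C a) = if a = p then 1 else 0 := by
  split_ifs with h
  · rw [h, ordAt, map_sub, expandAt_X, expandAt_C, add_sub_cancel_right,
      HahnSeries.ofPowerSeries_X, HahnSeries.order_single one_ne_zero]
  · rw [← algebraMap_X_sub_C, ordAt_algebraMap_eq_zero_iff p (Polynomial.X_sub_C_ne_zero a),
      Polynomial.eval_sub, Polynomial.eval_X, Polynomial.eval_C]
    exact sub_ne_zero.mpr (Ne.symm h)

theorem eval_num_ne_zero_and_eval_denom_ne_zero {w : RatFunc ℂ} {p : ℂ} (hw : w ≠ 0)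
    (h : ordAt p w = 0) : w.num.eval p ≠ 0 ∧ w.denom.eval p ≠ 0 := by
  have hmul : algebraMap (Polynomial ℂ) (RatFunc ℂ) w.num =
      w * algebraMap (Polynomial ℂ) (RatFunc ℂ) w.denom := by
    rw [← div_eq_iff (RatFunc.algebraMap_ne_zero w.denom_ne_zero), RatFunc.num_div_denom]
  have hiff : w.num.eval p ≠ 0 ↔ w.denom.eval p ≠ 0 := by
    rw [← ordAt_algebraMap_eq_zero_iff p (RatFunc.num_ne_zero hw),
      ← ordAt_algebraMap_eq_zero_iff p w.denom_ne_zero, hmul,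
      ordAt_mul p hw (RatFunc.algebraMap_ne_zero w.denom_ne_zero), h, zero_add]
  obtain ⟨A, B, hAB⟩ := RatFunc.isCoprime_num_denom w
  have heval := congrArg (Polynomial.eval p) hAB
  rw [Polynomial.eval_add, Polynomial.eval_mul, Polynomial.eval_mul, Polynomial.eval_one] at heval
  refine ⟨fun hnum => ?_, fun hdenom => ?_⟩
  · simp [hnum, not_not.mp (hiff.not.mp (not_not.mpr hnum))] at heval
  · simp [hdenom, not_not.mp (hiff.not.mpr (not_not.mpr hdenom))] at heval

theorem exists_eq_C_of_forall_ordAt_eq_zero {w : RatFunc ℂ} (hw : w ≠ 0)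
    (h : ∀ p, ordAt p w = 0) : ∃ c : ℂ, w = RatFunc.C c := by
  have hconst (P : Polynomial ℂ) (hP : ∀ p, P.eval p ≠ 0) : P = Polynomial.C (P.coeff 0) := by
    apply Polynomial.eq_C_of_degree_le_zero
    by_contra! hdeg
    obtain ⟨p, hp⟩ := IsAlgClosed.exists_root P hdeg.ne'
    exact hP p hp
  have hnum := hconst w.num fun p => (eval_num_ne_zero_and_eval_denom_ne_zero hw (h p)).1
  have hdenom := hconst w.denom fun p => (eval_num_ne_zero_and_eval_denom_ne_zero hw (h p)).2
  refine ⟨w.num.coeff 0 / w.denom.coeff 0, ?_⟩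
  rw [map_div₀, ← RatFunc.algebraMap_C, ← RatFunc.algebraMap_C, ← hnum, ← hdenom,
    RatFunc.num_div_denom]

/-- The residue of a rational function at `p`. -/
def resAt (p : ℂ) : RatFunc ℂ →ₗ[ℂ] ℂ where
  toFun w := (expandAt p w).coeff (-1)
  map_add' v w := by rw [map_add, HahnSeries.coeff_add]
  map_smul' c w := by
    rw [RatFunc.smul_eq_C_mul, map_mul, expandAt_C, HahnSeries.C_mul_eq_smul,
      HahnSeries.coeff_smul, RingHom.id_apply]

theorem resAt_apply (p : ℂ) (w : RatFunc ℂ) : resAt p w = (expandAt p w).coeff (-1) := rfl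

theorem resAt_ratDer (p : ℂ) (w : RatFunc ℂ) : resAt p (ratDer w) = 0 := by
  rw [resAt_apply, ← laurentDerivation_expandAt, coe_laurentDerivation, coeff_neg_one_ddt]

theorem resAt_logDeriv (p : ℂ) {w : RatFunc ℂ} (hw : w ≠ 0) :
    resAt p (ratDer.logDeriv w) = ordAt p w := by
  rw [ordAt, ← coeff_neg_one_logDeriv ((map_ne_zero _).mpr hw), RingDerivation.logDeriv,
    RingDerivation.logDeriv, laurentDerivation_expandAt, ← map_div₀, resAt_apply]

end Residues

section PartialFractions

variable {K : Type*} [Field K]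

theorem ratDer_algebraMap (P : Polynomial K) :
    ratDer (algebraMap _ (RatFunc K) P) = algebraMap _ (RatFunc K) P.derivative := by
  rw [ratDer, ratDerivation_algebraMap, polyDerivation_apply]
  simp [polyDeriv, Polynomial.sum]

theorem ratDer_C_mul (c : K) (w : RatFunc K) :
    ratDer (RatFunc.C c * w) = RatFunc.C c * ratDer w := by
  rw [RingDerivation.apply_mul, ratDer, ratDerivation_C, Derivation.zero_apply, map_zero, mul_zero,
    add_zero]

theorem ratDer_X_sub_C (a : K) : ratDer (RatFunc.X - RatFunc.C a) = 1 := by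
  rw [← algebraMap_X_sub_C, ratDer_algebraMap, Polynomial.derivative_X_sub_C, map_one]

theorem logDeriv_X_sub_C (a : K) :
    ratDer.logDeriv (RatFunc.X - RatFunc.C a) = (RatFunc.X - RatFunc.C a)⁻¹ := by
  rw [RingDerivation.logDeriv, ratDer_X_sub_C, one_div]

variable (K) in
/-- The rational functions `g' + ∑ c_a / (t - a)`, that is, the derivatives of the elementary
functions `g + ∑ c_a log (t - a)`. -/
def logIntegrable : AddSubgroup (RatFunc K) :=
  (AddMonoidHomClass.toAddMonoidHom (ratDer (K := K))).range ⊔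
    (Finsupp.linearCombination K fun a : K =>
      ratDer.logDeriv (RatFunc.X - RatFunc.C a)).toAddMonoidHom.range

theorem ratDer_mem_logIntegrable (g : RatFunc K) : ratDer g ∈ logIntegrable K :=
  AddSubgroup.mem_sup_left ⟨g, rfl⟩

variable [CharZero K]

theorem algebraMap_mem_logIntegrable (P : Polynomial K) :
    algebraMap _ (RatFunc K) P ∈ logIntegrable K := by
  induction P using Polynomial.induction_on' with
  | add P Q hP hQ => exact map_add (algebraMap _ (RatFunc K)) P Q ▸ add_mem hP hQ
  | monomial n a =>
    have hn : (n : K) + 1 ≠ 0 := Nat.cast_add_one_ne_zero n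
    have h := ratDer_mem_logIntegrable
      (algebraMap _ (RatFunc K) (Polynomial.monomial (n + 1) (a / (n + 1))))
    rwa [ratDer_algebraMap, Polynomial.derivative_monomial, Nat.add_sub_cancel, Nat.cast_add_one,
      div_mul_cancel₀ _ hn] at h

theorem pole_mem_logIntegrable (z a : K) (n : ℕ) :
    RatFunc.C z * (RatFunc.X - RatFunc.C a)⁻¹ ^ (n + 1) ∈ logIntegrable K := by
  cases n with
  | zero =>
    refine AddSubgroup.mem_sup_right ⟨Finsupp.single a z, ?_⟩
    simp [logDeriv_X_sub_C, RatFunc.smul_eq_C_mul]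
  | succ n =>
    have hn : -((n : K) + 1) ≠ 0 := neg_ne_zero.mpr (Nat.cast_add_one_ne_zero n)
    have h := ratDer_mem_logIntegrable
      (RatFunc.C (z / -((n : K) + 1)) * (RatFunc.X - RatFunc.C a) ^ (-(n + 1 : ℤ)))
    have hcast : ((-(n + 1 : ℤ) : ℤ) : RatFunc K) = RatFunc.C (-((n : K) + 1)) := by simp
    rwa [ratDer_C_mul, RingDerivation.apply_zpow, ratDer_X_sub_C, mul_one, hcast, ← mul_assoc,
      ← map_mul, div_mul_cancel₀ _ hn, ← neg_add', zpow_neg, ← inv_zpow,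
      show (n + 1 + 1 : ℤ) = (n + 1 + 1 : ℕ) by push_cast; rfl, zpow_natCast] at h

theorem mem_logIntegrable [IsAlgClosed K] (h : RatFunc K) : h ∈ logIntegrable K := by
  classical
  set s := h.denom.roots.toFinset with hs
  have hdenom : h.denom = ∏ a ∈ s, (Polynomial.X - Polynomial.C a) ^ h.denom.roots.count a := by
    rw [hs, ← Finset.prod_multiset_map_count]
    exact (IsAlgClosed.splits h.denom).eq_prod_roots_of_monic h.monic_denom
  obtain ⟨Q, r, hr, hQr⟩ := Polynomial.mul_prod_pow_inverse_eq_quo_add_sum_rem_mul_pow_inverse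
    (K := RatFunc K) (s := s) h.num (g := fun a => Polynomial.X - Polynomial.C a)
    (fun a _ => Polynomial.monic_X_sub_C a)
    (fun a _ b _ hab => Polynomial.isCoprime_X_sub_C_of_isUnit_sub (sub_ne_zero.mpr hab).isUnit)
    (fun a => h.denom.roots.count a) (gi := fun a => (RatFunc.X - RatFunc.C a)⁻¹)
    (fun a _ => by rw [algebraMap_X_sub_C, inv_mul_cancel₀ (X_sub_C_ne_zero a)])
  have hprod : h = algebraMap _ (RatFunc K) h.num *
      ∏ a ∈ s, (RatFunc.X - RatFunc.C a)⁻¹ ^ h.denom.roots.count a := by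
    conv_lhs => rw [← RatFunc.num_div_denom h, div_eq_mul_inv, hdenom, map_prod]
    simp only [map_pow, algebraMap_X_sub_C, inv_pow, Finset.prod_inv_distrib]
  rw [hprod, hQr]
  refine add_mem (algebraMap_mem_logIntegrable Q) (sum_mem fun a ha => sum_mem fun j _ => ?_)
  have hdegree := hr a ha j
  rw [Polynomial.degree_X_sub_C] at hdegree
  rw [Polynomial.eq_C_of_degree_le_zero (Nat.WithBot.lt_one_iff_le_zero.mp hdegree),
    RatFunc.algebraMap_C]
  exact pole_mem_logIntegrable _ a j

theorem exists_eq_ratDer_add_linearCombination_logDeriv [IsAlgClosed K] (h : RatFunc K) :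
    ∃ (g : RatFunc K) (c : K →₀ K), h = ratDer g +
      Finsupp.linearCombination K (fun a => ratDer.logDeriv (RatFunc.X - RatFunc.C a)) c := by
  obtain ⟨_, ⟨g, rfl⟩, _, ⟨c, rfl⟩, h⟩ := AddSubgroup.mem_sup.mp (mem_logIntegrable h)
  exact ⟨g, c, h.symm⟩

end PartialFractions

section LogarithmicForms

theorem exists_int_orthogonal_relations {ι V : Type*} [AddCommGroup V] [Module ℚ V] (s : Finset ι)
    {c : ι → V} {i₀ : ι} (hi₀ : i₀ ∈ s) (hc : c i₀ ≠ 0) :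
    ∃ n : ι → ℤ, n i₀ ≠ 0 ∧
      ∀ m : ι → ℤ, ∑ i ∈ s, m i • c i = 0 → ∑ i ∈ s, n i * m i = 0 := by
  obtain ⟨ℓ, hℓ⟩ := Module.Projective.exists_dual_ne_zero ℚ hc
  obtain ⟨N, hN⟩ := IsLocalization.exist_integer_multiples (nonZeroDivisors ℤ) s fun i => ℓ (c i)
  choose! n hn using hN
  simp only [eq_intCast, zsmul_eq_mul] at hn
  have hN0 : ((N : ℤ) : ℚ) ≠ 0 := Int.cast_ne_zero.mpr (nonZeroDivisors.coe_ne_zero N)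
  refine ⟨n, fun h => mul_ne_zero hN0 hℓ ?_, fun m hm => ?_⟩
  · rw [← hn i₀ hi₀, h, Int.cast_zero]
  · have hsum : ((∑ i ∈ s, n i * m i : ℤ) : ℚ) = (N : ℤ) * ℓ (∑ i ∈ s, m i • c i) := by
      push_cast
      simp only [map_sum, map_zsmul, zsmul_eq_mul, Finset.mul_sum]
      exact Finset.sum_congr rfl fun i hi => by rw [hn i hi]; ring
    rw [hm, map_zero, mul_zero] at hsum
    exact_mod_cast hsum

theorem exists_prod_zpow_eq_C_of_sum_logDeriv_eq_ratDer {ι : Type*} {s : Finset ι} {c : ι → ℂ}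
    {w : ι → RatFunc ℂ} (hw : ∀ i ∈ s, w i ≠ 0) {g : RatFunc ℂ}
    (h : ∑ i ∈ s, c i • ratDer.logDeriv (w i) = ratDer g) {i₀ : ι} (hi₀ : i₀ ∈ s)
    (hc : c i₀ ≠ 0) :
    ∃ n : ι → ℤ, n i₀ ≠ 0 ∧ ∃ κ : ℂ, ∏ i ∈ s, w i ^ n i = RatFunc.C κ := by
  obtain ⟨n, hn0, hn⟩ := exists_int_orthogonal_relations s hi₀ hc
  refine ⟨n, hn0, exists_eq_C_of_forall_ordAt_eq_zero
    (Finset.prod_ne_zero_iff.mpr fun i hi => zpow_ne_zero _ (hw i hi)) fun p => ?_⟩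
  rw [ordAt_prod_zpow p s hw]
  refine hn _ ?_
  rw [← resAt_ratDer p g, ← h, map_sum]
  exact Finset.sum_congr rfl fun i hi => by
    rw [map_smul, resAt_logDeriv p (hw i hi), smul_eq_mul, zsmul_eq_mul, mul_comm]

end LogarithmicForms

section RationalDerivative

open PowerSeries

variable {R : PowerSeries ℂ} {h0 : constantCoeff R = 0} {hne : R ≠ 0} {ρ : RatFunc ℂ}

theorem Phi_ratToLaurent_X_sub_C (hρ : ratToLaurent ρ = toLaurent R) (a : ℂ) :
    Phi R h0 hne (ratToLaurent (RatFunc.X - RatFunc.C a)) = ratToLaurent (ρ - RatFunc.C a) := by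
  simp only [map_sub, ratToLaurent_C, ratToLaurent_X, Phi_C, Phi_toLaurent, hρ,
    subst_X (HasSubst.of_constantCoeff_zero' h0)]

include h0 hne in
theorem sub_C_ne_zero (hρ : ratToLaurent ρ = toLaurent R) (a : ℂ) : ρ - RatFunc.C a ≠ 0 := by
  rw [← map_ne_zero ratToLaurent, ← Phi_ratToLaurent_X_sub_C (h0 := h0) (hne := hne) hρ]
  exact (map_ne_zero _).mpr ((map_ne_zero _).mpr (X_sub_C_ne_zero a))

theorem mul_Phi_logDeriv_X_sub_C (hρ : ratToLaurent ρ = toLaurent R) (a : ℂ) :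
    ddt (toLaurent R) * Phi R h0 hne (ratToLaurent (ratDer.logDeriv (RatFunc.X - RatFunc.C a))) =
      ratToLaurent (ratDer.logDeriv (ρ - RatFunc.C a)) := by
  rw [RingDerivation.logDeriv, RingDerivation.logDeriv, map_div₀, map_div₀, map_div₀,
    Phi_ratToLaurent_X_sub_C hρ, ← ddt_ratToLaurent, ← ddt_ratToLaurent,
    ← Phi_ratToLaurent_X_sub_C (h0 := h0) (hne := hne) hρ, ddt_Phi, mul_div_assoc]

variable {f : LaurentSeries ℂ} {b : RatFunc ℂ} {c : ℂ →₀ ℂ}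

theorem sum_logDeriv_div_X_sub_C_eq_ratDer (hρ : ratToLaurent ρ = toLaurent R)
    (hf : Phi R h0 hne f = f + ratToLaurent b)
    (hd : ddt f = ratToLaurent (∑ a ∈ c.support,
      c a • ratDer.logDeriv (RatFunc.X - RatFunc.C a))) :
    ∑ a ∈ c.support, c a • ratDer.logDeriv ((ρ - RatFunc.C a) / (RatFunc.X - RatFunc.C a)) =
      ratDer b := by
  have hrel : ratToLaurent (∑ a ∈ c.support, c a • ratDer.logDeriv (ρ - RatFunc.C a)) =
      ratToLaurent (∑ a ∈ c.support, c a • ratDer.logDeriv (RatFunc.X - RatFunc.C a)) +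
        ratToLaurent (ratDer b) := by
    have hddt := ddt_Phi (h0 := h0) (hne := hne) f
    rw [hf, ← coe_laurentDerivation, map_add, coe_laurentDerivation, hd, ddt_ratToLaurent] at hddt
    rw [hddt]
    simp only [RatFunc.smul_eq_C_mul, map_sum, map_mul, ratToLaurent_C, Phi_C, Finset.mul_sum,
      ← mul_Phi_logDeriv_X_sub_C (h0 := h0) (hne := hne) hρ, mul_left_comm]
  rw [← map_add] at hrel
  rw [← sub_eq_iff_eq_add'.mpr (ratToLaurent.injective hrel), ← Finset.sum_sub_distrib]
  exact Finset.sum_congr rfl fun a _ => by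
    rw [RingDerivation.logDeriv_div _ (sub_C_ne_zero (h0 := h0) (hne := hne) hρ a)
      (X_sub_C_ne_zero a), smul_sub]

theorem ordAt_prod_X_sub_C_zpow (p : ℂ) (s : Finset ℂ) (n : ℂ → ℤ) :
    ordAt p (∏ a ∈ s, (RatFunc.X - RatFunc.C a) ^ n a) = if p ∈ s then n p else 0 := by
  simp only [ordAt_prod_zpow p s (fun a _ => X_sub_C_ne_zero a), ordAt_X_sub_C, mul_ite, mul_one,
    mul_zero, Finset.sum_ite_eq']

theorem resAt_sum_logDeriv_X_sub_C (p : ℂ) :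
    resAt p (∑ a ∈ c.support, c a • ratDer.logDeriv (RatFunc.X - RatFunc.C a)) = c p := by
  simp only [map_sum, map_smul, resAt_logDeriv p (X_sub_C_ne_zero _), ordAt_X_sub_C, Int.cast_ite,
    Int.cast_one, Int.cast_zero, smul_eq_mul, mul_ite, mul_one, mul_zero, Finset.sum_ite_eq']
  exact ite_eq_left_iff.mpr fun hp => (Finsupp.notMem_support_iff.mp hp).symm

theorem eq_zero_of_Phi_prod_X_sub_C_zpow (hiter : ∀ n : ℕ, 1 ≤ n → iter R n ≠ X) {s : Finset ℂ}
    (hs : 0 ∉ s) {n : ℂ → ℤ} {κ : ℂ}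
    (h : Phi R h0 hne (ratToLaurent (∏ a ∈ s, (RatFunc.X - RatFunc.C a) ^ n a)) =
      HahnSeries.C κ * ratToLaurent (∏ a ∈ s, (RatFunc.X - RatFunc.C a) ^ n a)) :
    ∀ a ∈ s, n a = 0 := by
  intro a ha
  set u : RatFunc ℂ := ∏ a ∈ s, (RatFunc.X - RatFunc.C a) ^ n a with hu
  have hu0 : u ≠ 0 := Finset.prod_ne_zero_iff.mpr fun a _ => zpow_ne_zero _ (X_sub_C_ne_zero a)
  have horder : (ratToLaurent u).order = 0 := by
    rw [← expandAt_zero, ← ordAt, hu, ordAt_prod_X_sub_C_zpow, if_neg hs]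
  have hκ : κ = 1 := by
    rw [eq_coeff_one_zpow_order_of_Phi_eq ((map_ne_zero _).mpr hu0) h, horder, zpow_zero]
  rw [hκ, map_one, one_mul] at h
  have hconst := eq_C_of_Phi_eq_self hiter h
  rw [← ratToLaurent_C] at hconst
  have hord := ordAt_prod_X_sub_C_zpow a s n
  rw [← hu, ratToLaurent.injective hconst, ordAt_C, if_pos ha] at hord
  exact hord.symm

theorem eq_zero_of_ddt_eq_sum_logDeriv_X_sub_C (hrat : IsRational (toLaurent R))
    (hiter : ∀ n : ℕ, 1 ≤ n → iter R n ≠ X) (hf : Phi R h0 hne f = f + ratToLaurent b)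
    (hd : ddt f = ratToLaurent (∑ a ∈ c.support,
      c a • ratDer.logDeriv (RatFunc.X - RatFunc.C a))) : c = 0 := by
  obtain ⟨ρ, hρ⟩ := hrat
  by_contra! hc
  obtain ⟨a₀, ha₀⟩ := Finsupp.support_nonempty_iff.mpr hc
  have h0c : (0 : ℂ) ∉ c.support := by
    rw [Finsupp.notMem_support_iff, ← resAt_sum_logDeriv_X_sub_C 0, resAt_apply, expandAt_zero,
      ← hd, coeff_neg_one_ddt]
  obtain ⟨n, hn, κ, hκ⟩ := exists_prod_zpow_eq_C_of_sum_logDeriv_eq_ratDer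
    (fun a _ => div_ne_zero (sub_C_ne_zero (h0 := h0) (hne := hne) hρ a) (X_sub_C_ne_zero a))
    (sum_logDeriv_div_X_sub_C_eq_ratDer hρ hf hd) ha₀ (Finsupp.mem_support_iff.mp ha₀)
  refine hn (eq_zero_of_Phi_prod_X_sub_C_zpow (h0 := h0) (hne := hne) (κ := κ) hiter h0c ?_ a₀ ha₀)
  simp only [div_zpow, Finset.prod_div_distrib] at hκ
  rw [div_eq_iff (Finset.prod_ne_zero_iff.mpr fun a _ => zpow_ne_zero _ (X_sub_C_ne_zero a))] at hκ
  rw [← ratToLaurent_C, ← map_mul, ← hκ]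
  simp only [map_prod, map_zpow₀, Phi_ratToLaurent_X_sub_C hρ]

theorem isRational_of_isRational_ddt (hrat : IsRational (toLaurent R))
    (hiter : ∀ n : ℕ, 1 ≤ n → iter R n ≠ X) (hf : Phi R h0 hne f = f + ratToLaurent b)
    (hd : IsRational (ddt f)) : IsRational f := by
  obtain ⟨h, hh⟩ := hd
  obtain ⟨g, c, rfl⟩ := exists_eq_ratDer_add_linearCombination_logDeriv h
  obtain ⟨g₁, hg₁⟩ := Phi_ratToLaurent_mem_fieldRange (h0 := h0) (hne := hne) hrat g
  have hsub : ddt (f - ratToLaurent g) = ratToLaurent (∑ a ∈ c.support,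
      c a • ratDer.logDeriv (RatFunc.X - RatFunc.C a)) := by
    rw [← coe_laurentDerivation, map_sub, coe_laurentDerivation, ← hh, ddt_ratToLaurent, map_add,
      add_sub_cancel_left]
    rfl
  obtain rfl : c = 0 := by
    refine eq_zero_of_ddt_eq_sum_logDeriv_X_sub_C (h0 := h0) (hne := hne) (b := b + g - g₁) hrat
      hiter ?_ hsub
    rw [map_sub, hf, ← hg₁, map_sub, map_add]
    ring
  rw [Finsupp.support_zero, Finset.sum_empty, map_zero] at hsub
  refine ⟨g + RatFunc.C ((f - ratToLaurent g).coeff 0), ?_⟩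
  rw [map_add, ratToLaurent_C, ← eq_C_of_ddt_eq_zero hsub, add_sub_cancel]

end RationalDerivative

section DifferentialAlgebraicity

theorem diffAlgebraic_comp_iff {K F E : Type*} [Field K] [Field F] [Field E] {ι : K →+* F}
    (j : F →+* E) {D : F → F} {D' : E → E} (h : ∀ x, D' (j x) = j (D x)) {f : F} :
    DiffAlgebraic (j.comp ι) D' (j f) ↔ DiffAlgebraic ι D f := by
  have hiterate (i : ℕ) : D'^[i] (j f) = j (D^[i] f) :=
    ((Function.Semiconj.iterate_right (fun x => (h x).symm) i) f).symm
  simp only [DiffAlgebraic, hiterate, ← MvPolynomial.hom_eval₂, map_eq_zero]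

theorem mem_fieldRange_or_derivation_mem_fieldRange {K F : Type*} [Field K] [CharZero K] [Field F]
    {ι : K →+* F} {D : Derivation ℤ F F} {φ : F →+* F} {r b : K} {f Ψ : F}
    (hDK : ∀ a, D (ι a) ∈ ι.fieldRange) (hφK : ∀ a, φ (ι a) ∈ ι.fieldRange)
    (hfix : ∀ x, φ x = x → x ∈ ι.fieldRange) (hchain : ∀ x, D (φ x) = ι r * φ (D x))
    (hφΨ : φ Ψ = ι r * Ψ) (hΨ : DiffTranscendental ι D Ψ) (hφf : φ f = f + ι b)
    (hf : DiffAlgebraic ι D f) : f ∈ ι.fieldRange ∨ D f ∈ ι.fieldRange := by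
  let := ι.toAlgebra
  exact mem_bot_or_derivation_mem_bot hDK hφK hfix hchain hφΨ
    (diffTranscendental_iff_algebraicIndependent.mp hΨ) hφf
    (mt diffTranscendental_iff_algebraicIndependent.mpr (not_not.mpr hf))

open PowerSeries

variable {R : PowerSeries ℂ} {h0 : constantCoeff R = 0} {hne : R ≠ 0} {f : LaurentSeries ℂ}
  {b : RatFunc ℂ}

theorem ddt_ratToLaurent_mem_fieldRange (q : RatFunc ℂ) :
    ddt (ratToLaurent q) ∈ ratToLaurent.fieldRange :=
  ⟨ratDer q, (ddt_ratToLaurent q).symm⟩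

theorem isRational_or_isRational_ddt (hrat : IsRational (toLaurent R))
    (hiter : ∀ n : ℕ, 1 ≤ n → iter R n ≠ X) {Ψ : LaurentSeries ℂ}
    (hΦΨ : Phi R h0 hne Ψ = ddt (toLaurent R) * Ψ) (hΨ : DiffTranscendental ratToLaurent ddt Ψ)
    (hΦf : Phi R h0 hne f = f + ratToLaurent b) (hf : DiffAlgebraic ratToLaurent ddt f) :
    IsRational f ∨ IsRational (ddt f) := by
  obtain ⟨ρ, hρ⟩ := hrat
  have hR := ddt_ratToLaurent ρ
  rw [hρ] at hR
  rw [hR] at hΦΨ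
  rw [← coe_laurentDerivation] at hΨ hf ⊢
  refine mem_fieldRange_or_derivation_mem_fieldRange ?_
    (Phi_ratToLaurent_mem_fieldRange ⟨ρ, hρ⟩) (fun x hx => ?_) ?_ hΦΨ hΨ hΦf hf
  · exact coe_laurentDerivation ▸ ddt_ratToLaurent_mem_fieldRange
  · exact ⟨RatFunc.C (x.coeff 0), by rw [ratToLaurent_C, ← eq_C_of_Phi_eq_self hiter hx]⟩
  · exact coe_laurentDerivation ▸ hR ▸ ddt_Phi

theorem isRational_or_isRational_ddt_of_logField (hrat : IsRational (toLaurent R))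
    (hiter : ∀ n : ℕ, 1 ≤ n → iter R n ≠ X) (h1 : coeff 1 R = 0) {l : ℂ} {Ψ : LogField}
    (hΦΨ : PhiLog R h0 hne l Ψ = toLog (ddt (toLaurent R)) * Ψ)
    (hΨ : DiffTranscendental (toLog.comp ratToLaurent) ddtLog Ψ)
    (hΦf : Phi R h0 hne f = f + ratToLaurent b) (hf : DiffAlgebraic ratToLaurent ddt f) :
    IsRational f ∨ IsRational (ddt f) := by
  obtain ⟨ρ, hρ⟩ := hrat
  have hR := ddt_ratToLaurent ρ
  rw [hρ] at hR
  rw [hR] at hΦΨ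
  rw [← coe_ddtLogDerivation] at hΨ
  have hmem (x : LaurentSeries ℂ) :
      toLog x ∈ (toLog.comp ratToLaurent).fieldRange ↔ x ∈ ratToLaurent.fieldRange :=
    ⟨fun ⟨a, ha⟩ => ⟨a, toLog.injective ha⟩, fun ⟨a, ha⟩ => ⟨a, congrArg toLog ha⟩⟩
  have h := mem_fieldRange_or_derivation_mem_fieldRange (f := toLog f) (b := b)
    (fun q => ?_) (fun q => ?_) (fun x hx => ?_) (fun x => ?_) hΦΨ hΨ ?_
    ((diffAlgebraic_comp_iff toLog ddtLogDerivation_toLog).mpr hf)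
  · rwa [ddtLogDerivation_toLog, hmem, hmem] at h
  · rw [RingHom.comp_apply, ddtLogDerivation_toLog, hmem]
    exact ddt_ratToLaurent_mem_fieldRange q
  · rw [RingHom.comp_apply, PhiLog_toLog, hmem]
    exact Phi_ratToLaurent_mem_fieldRange ⟨ρ, hρ⟩ q
  · obtain ⟨c, rfl⟩ := exists_eq_C_of_PhiLog_eq_self h1 hiter hx
    exact ⟨RatFunc.C c, by rw [RingHom.comp_apply, ratToLaurent_C]⟩
  · rw [ddtLogDerivation_PhiLog, hR, RingHom.comp_apply]
  · rw [PhiLog_toLog, hΦf, map_add, RingHom.comp_apply]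

end DifferentialAlgebraicity

end IterFE

end

theorem mainTheorem5
    (R : PowerSeries ℂ)
    (hrat : IterFE.IsRational (IterFE.toLaurent R))
    (h0 : PowerSeries.constantCoeff R = 0)
    (hne : R ≠ 0)
    (hiter : ∀ n : ℕ, 1 ≤ n → IterFE.iter R n ≠ PowerSeries.X)
    -- a differentially transcendental solution `Ψ ∈ 𝔽` of `Φ_R(Ψ) = R' Ψ`, where
    -- `𝔽 = ℂ((t))` if `R'(0) ≠ 0` and `𝔽 = ℂ((t))(log t)` if `R'(0) = 0`
    (hΨ :
      (PowerSeries.coeff 1 R ≠ 0 ∧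
        ∃ Ψ : LaurentSeries ℂ,
          IterFE.Phi R h0 hne Ψ = IterFE.ddt (IterFE.toLaurent R) * Ψ ∧
          IterFE.DiffTranscendental IterFE.ratToLaurent IterFE.ddt Ψ) ∨
      (PowerSeries.coeff 1 R = 0 ∧
        ∃ l : ℂ, Complex.exp l = IterFE.leadCoeff R ∧
        ∃ Ψ : IterFE.LogField,
          IterFE.PhiLog R h0 hne l Ψ =
            IterFE.toLog (IterFE.ddt (IterFE.toLaurent R)) * Ψ ∧
          IterFE.DiffTranscendental (IterFE.toLog.comp IterFE.ratToLaurent) IterFE.ddtLog Ψ))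
    (b : RatFunc ℂ) (f : LaurentSeries ℂ)
    (hf : IterFE.Phi R h0 hne f = f + IterFE.ratToLaurent b) :
    IterFE.IsRational f ∨ IterFE.DiffTranscendental IterFE.ratToLaurent IterFE.ddt f := by
  by_cases hfa : IterFE.DiffAlgebraic IterFE.ratToLaurent IterFE.ddt f
  · refine Or.inl ?_
    have h : IterFE.IsRational f ∨ IterFE.IsRational (IterFE.ddt f) := by
      rcases hΨ with ⟨-, Ψ, hΦΨ, hΨ⟩ | ⟨h1, l, -, Ψ, hΦΨ, hΨ⟩
      · exact IterFE.isRational_or_isRational_ddt hrat hiter hΦΨ hΨ hf hfa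
      · exact IterFE.isRational_or_isRational_ddt_of_logField hrat hiter h1 hΦΨ hΨ hf hfa
    exact h.elim id (IterFE.isRational_of_isRational_ddt hrat hiter hf)
  · exact Or.inr hfa
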